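/- Second-order Trotter gate complexity (norm scaling). Let $\rho>0$ (mass density), $h>0$ (grid interval), let $S_{\mathrm{comp}}\in\mathbb{R}^{6\times 6}$ be symmetric positive definite (compliance matrix), and let $n\ge 1$, so that there are $2^n$ grid points per coordinate. Put $\sigma_{01}=\begin{pmatrix}0&1\\0&0\end{pmatrix}$, $\sigma_{10}=\sigma_{01}^{\mathsf T}$, and for $1\le k\le n$, $\alpha\in\{1,2,3\}$, $$S_k^{\mathrm{cell}}=I^{\otimes(n-k)}\otimes\sigma_{01}\otimes\sigma_{10}^{\otimes(k-1)}-I^{\otimes(n-k)}\otimes\sigma_{10}\otimes\sigma_{01}^{\otimes(k-1)},\quad S_k^{(\alpha)}=I^{\otimes n(\alpha-1)}\otimes S_k^{\mathrm{cell}}\otimes I^{\otimes n(3-\alpha)},\quad D^{(\alpha)}=\frac1{2h}\sum_{k=1}^nS_k^{(\alpha)}.$$ Let $$A^{(\alpha)}=\begin{pmatrix}0&C^{(\alpha)}&0\\(C^{(\alpha)})^{\mathsf T}&0&0\\0&0&0\end{pmatrix}\in\mathbb{R}^{16\times16}\quad(\text{blocks }3,6,7),\qquad B_{\mathrm{cell}}=\mathrm{diag}(\rho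 I_3,S_{\mathrm{comp}},I_7),$$ where, with $e_1,\dots,e_6$ the standard row basis vectors of $\mathbb{R}^6$, $C^{(1)}$ has rows $e_1,e_4,e_5$, $C^{(2)}$ has rows $e_4,e_2,e_6$, and $C^{(3)}$ has rows $e_5,e_6,e_3$. Set $A=\sum_{\alpha}A^{(\alpha)}\otimes D^{(\alpha)}$, $B=B_{\mathrm{cell}}\otimes I^{\otimes 3n}$ and $\mathcal{H}=iB^{-1/2}AB^{-1/2}$. For each $\alpha$ let $(\phi_j^{(\alpha)})_{j=0}^{15}$ be any orthonormal eigenbasis of $B_{\mathrm{cell}}^{-1/2}A^{(\alpha)}B_{\mathrm{cell}}^{-1/2}$ with eigenvalues $\lambda_j^{(\alpha)}$, put $H_{jk}^{(\alpha)}=|\phi_j^{(\alpha)}\rangle\langle\phi_j^{(\alpha)}|\otimes\frac{i\lambda_j^{(\alpha)}}{2h}S_k^{(\alpha)}$ (so that $\mathcal{H}=\sum_{\alpha,j,k}H_{jk}^{(\alpha)}$), and let $$U_2(\tau)=\prod_{\alpha=1}^{3}\prod_{j=0}^{15}\prod_{k=1}^{n}e^{-iH_{jk}^{(\alpha)}\tau/2}\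 \prod_{\alpha=3}^{1}\prod_{j=15}^{0}\prod_{k=n}^{1}e^{-iH_{jk}^{(\alpha)}\tau/2}$$ be the symmetric second-order Trotter step, where the first triple product is ordered with the factor $(\alpha,j,k)=(3,15,n)$ leftmost and $(1,0,1)$ rightmost (lexicographically decreasing), and the second one in the opposite order. Then for all $T>0$ and $\epsilon>0$ there are an integer $m\ge1$ and a circuit made of arbitrary one-qubit gates and CNOT gates, acting on exactly $3n+4$ qubits (no ancillas), that implements $U_2(T/m)^m$ exactly, satisfies $\|e^{-i\mathcal{H}T}-U_2(T/m)^m\|\le\epsilon$ in operator norm, and uses at most $$\max\bigl\{N,\ 2(432n^2+378)\bigr\},\qquad N:=\frac{2880^{3/2}\,T^{3/2}}{h^{3/2}\epsilon^{1/2}}\,\rho^{-3/4}\,\|S_{\mathrm{comp}}^{-1}\|^{3/4}\,n^{3/2}\,(432n^2+378)$$ CNOT gates; that is, at most $N$ CNOT gates as soon as $N$ is at least the budget $2(432n^2+378)$ of a single Trotter step. In particular, for fixed $h,\rho,S_{\mathrm{comp}}$ there is a constant $c$ with $N\le c\,\frac{T^{3/2}}{\epsilon^{1/2}}\,n^{7/2}$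 for all $n\ge1$, $T>0$, $\epsilon>0$. -/

import Mathlib

open scoped Matrix.Norms.L2Operator

namespace ElasticWave

noncomputable section

/-! ### Quantum circuits over one-qubit gates and CNOT -/

/-- The tensor product over the qubits `q : Q` of the one-qubit operators `f q`, as a matrix in
the computational basis, whose elements are the bit strings `Q → Fin 2`. -/
def tensorOp {Q : Type*} [Fintype Q] (f : Q → Matrix (Fin 2) (Fin 2) ℂ) :
    Matrix (Q → Fin 2) (Q → Fin 2) ℂ :=
  Matrix.of fun x y => ∏ q, f q (x q) (y q)

/-- Elementary gates on a set `Q` of qubits: an arbitrary unitary on one qubit, or a CNOT with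
control `c` and target `t`. -/
inductive Gate (Q : Type*) where
  | single (q : Q) (u : Matrix.unitaryGroup (Fin 2) ℂ) : Gate Q
  | cnot (c t : Q) (hne : c ≠ t) : Gate Q

/-- The unitary matrix of a gate. A CNOT maps `|y⟩` to the basis state in which the target bit
`y t` is replaced by `y t + y c` modulo 2. -/
def Gate.unitary {Q : Type*} [Fintype Q] [DecidableEq Q] :
    Gate Q → Matrix (Q → Fin 2) (Q → Fin 2) ℂ
  | .single q u => tensorOp fun r => if r = q then (u : Matrix (Fin 2) (Fin 2) ℂ) else 1
  | .cnot c t _ => Matrix.of fun x y => if x = Function.update y t (y t + y c) then 1 else 0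

/-- Number of CNOT gates contributed by a single gate. -/
def Gate.cnotCost {Q : Type*} : Gate Q → ℕ
  | .single _ _ => 0
  | .cnot _ _ _ => 1

/-- A circuit is a finite list of gates; the head of the list is applied last, so the circuit
implements the product of its gates in the order written. All the qubits available are those
of `Q`: there are no ancillas besides them. -/
abbrev Circuit (Q : Type*) := List (Gate Q)

/-- The unitary implemented by a circuit. -/
def Circuit.unitary {Q : Type*} [Fintype Q] [DecidableEq Q] (C : Circuit Q) :
    Matrix (Q → Fin 2) (Q → Fin 2) ℂ :=
  (C.map Gate.unitary).prod

/-- The number of CNOT gates in a circuit. -/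
def Circuit.cnotCount {Q : Type*} (C : Circuit Q) : ℕ :=
  (C.map Gate.cnotCost).sum

/-! ### Registers -/

/-- The spatial qubits: `(α, i)` is the bit of weight `2 ^ i` of the grid index along axis `α`. -/
abbrev SpaceQubit (n : ℕ) := Fin 3 × Fin n

/-- All qubits: four qubits for the state register, `n` qubits for each of the three axes. -/
abbrev Qubit (n : ℕ) := Fin 4 ⊕ SpaceQubit n

/-- The index `0, …, 15` encoded by the four bits of the state register (bit `i` has
weight `2 ^ i`). -/
def stateIndex (x : Fin 4 → Fin 2) : Fin 16 := (finFunctionFinEquiv x : Fin (2 ^ 4))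

/-- The operator `X ⊗ Y`, with `X` on the state register and `Y` on the spatial register. -/
def onRegisters {n : ℕ} (X : Matrix (Fin 16) (Fin 16) ℂ)
    (Y : Matrix (SpaceQubit n → Fin 2) (SpaceQubit n → Fin 2) ℂ) :
    Matrix (Qubit n → Fin 2) (Qubit n → Fin 2) ℂ :=
  Matrix.of fun x y =>
    X (stateIndex fun i => x (Sum.inl i)) (stateIndex fun i => y (Sum.inl i)) *
      Y (fun q => x (Sum.inr q)) (fun q => y (Sum.inr q))

/-! ### The discretized first-order system -/

def sigma01 : Matrix (Fin 2) (Fin 2) ℂ := !![0, 1; 0, 0]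

def sigma10 : Matrix (Fin 2) (Fin 2) ℂ := !![0, 0; 1, 0]

/-- `I^{⊗(n-k)} ⊗ a ⊗ b^{⊗(k-1)}` on axis `α` and the identity on the other axes. The term
number `k` (from `1` to `n`) has Lean index `k - 1`, which is also the position of the bit
that carries `a`; the lower bits carry `b`. -/
def axisString {n : ℕ} (a b : Matrix (Fin 2) (Fin 2) ℂ) (α : Fin 3) (k : Fin n) :
    Matrix (SpaceQubit n → Fin 2) (SpaceQubit n → Fin 2) ℂ :=
  tensorOp fun q => if q.1 = α then (if q.2 = k then a else if q.2 < k then b else 1) else 1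

/-- The operator `S_k^{(α)}`. -/
def shiftTerm {n : ℕ} (α : Fin 3) (k : Fin n) :
    Matrix (SpaceQubit n → Fin 2) (SpaceQubit n → Fin 2) ℂ :=
  axisString sigma01 sigma10 α k - axisString sigma10 sigma01 α k

/-- The central difference operator `D^{(α)} = (1 / 2h) ∑_k S_k^{(α)}` along axis `α`. -/
def diffOp (n : ℕ) (h : ℝ) (α : Fin 3) :
    Matrix (SpaceQubit n → Fin 2) (SpaceQubit n → Fin 2) ℂ :=
  (1 / (2 * (h : ℂ))) • ∑ k : Fin n, shiftTerm α k

/-- The matrices `C^{(1)}, C^{(2)}, C^{(3)}`. -/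
def cMat : Fin 3 → Matrix (Fin 3) (Fin 6) ℂ :=
  ![!![1, 0, 0, 0, 0, 0;
       0, 0, 0, 1, 0, 0;
       0, 0, 0, 0, 1, 0],
    !![0, 0, 0, 1, 0, 0;
       0, 1, 0, 0, 0, 0;
       0, 0, 0, 0, 0, 1],
    !![0, 0, 0, 0, 1, 0;
       0, 0, 0, 0, 0, 1;
       0, 0, 1, 0, 0, 0]]

/-- Concatenation of the three velocity, six stress and seven padding components. -/
def blockEquiv : Fin 3 ⊕ (Fin 6 ⊕ Fin 7) ≃ Fin 16 :=
  (Equiv.sumCongr (Equiv.refl (Fin 3)) finSumFinEquiv).trans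
    (finSumFinEquiv (m := 3) (n := 6 + 7))

/-- The `16 × 16` matrix `A^{(α)}`. -/
def aCell (α : Fin 3) : Matrix (Fin 16) (Fin 16) ℂ :=
  Matrix.reindex blockEquiv blockEquiv
    (Matrix.fromBlocks 0 (Matrix.fromCols (cMat α) 0)
      (Matrix.fromRows (cMat α).transpose 0) 0)

/-- The `16 × 16` matrix `B_cell = diag(ρ I, S, I)`. -/
def bCell (ρ : ℝ) (S : Matrix (Fin 6) (Fin 6) ℝ) : Matrix (Fin 16) (Fin 16) ℂ :=
  Matrix.reindex blockEquiv blockEquiv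
    (Matrix.fromBlocks ((ρ : ℂ) • 1) 0 0
      (Matrix.fromBlocks (S.map fun x => (x : ℂ)) 0 0 1))

/-- `A = ∑_α A^{(α)} ⊗ D^{(α)}`. -/
def aFull (n : ℕ) (h : ℝ) : Matrix (Qubit n → Fin 2) (Qubit n → Fin 2) ℂ :=
  ∑ α : Fin 3, onRegisters (aCell α) (diffOp n h α)

/-- `B = B_cell ⊗ I`. -/
def bFull (n : ℕ) (ρ : ℝ) (S : Matrix (Fin 6) (Fin 6) ℝ) :
    Matrix (Qubit n → Fin 2) (Qubit n → Fin 2) ℂ :=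
  onRegisters (bCell ρ S) 1

/-- `X^{-1/2}` for a positive definite Hermitian matrix `X`, by functional calculus. -/
def invSqrt {ι : Type*} [Fintype ι] [DecidableEq ι] (X : Matrix ι ι ℂ) : Matrix ι ι ℂ :=
  cfc (fun x : ℝ => x ^ (-(1 / 2) : ℝ)) X

/-- The Hamiltonian `ℋ = i B^{-1/2} A B^{-1/2}`. -/
def hamiltonian (n : ℕ) (h ρ : ℝ) (S : Matrix (Fin 6) (Fin 6) ℝ) :
    Matrix (Qubit n → Fin 2) (Qubit n → Fin 2) ℂ :=
  Complex.I • (invSqrt (bFull n ρ S) * aFull n h * invSqrt (bFull n ρ S))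

/-- The time evolution operator `e^{-iXt}`. -/
def evolution {ι : Type*} [Fintype ι] [DecidableEq ι] (X : Matrix ι ι ℂ) (t : ℝ) :
    Matrix ι ι ℂ :=
  NormedSpace.exp ((-(Complex.I * (t : ℂ))) • X)

/-! ### The second-order product formula -/

/-- The Hermitian matrix `B_cell^{-1/2} A^{(α)} B_cell^{-1/2}` on the state register. -/
def stateMat (ρ : ℝ) (S : Matrix (Fin 6) (Fin 6) ℝ) (α : Fin 3) : Matrix (Fin 16) (Fin 16) ℂ :=
  invSqrt (bCell ρ S) * aCell α * invSqrt (bCell ρ S)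

/-- Eigendecompositions of the three matrices `B_cell^{-1/2} A^{(α)} B_cell^{-1/2}`: orthonormal
bases of eigenvectors `φ_j^{(α)}`, with real eigenvalues `λ_j^{(α)}`. -/
structure Eigendecomposition (ρ : ℝ) (S : Matrix (Fin 6) (Fin 6) ℝ) where
  vec : Fin 3 → OrthonormalBasis (Fin 16) ℂ (EuclideanSpace ℂ (Fin 16))
  val : Fin 3 → Fin 16 → ℝ
  eigen : ∀ α j,
    Matrix.mulVec (stateMat ρ S α) (vec α j).ofLp = (val α j : ℂ) • (vec α j).ofLp

variable {ρ : ℝ} {S : Matrix (Fin 6) (Fin 6) ℝ}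

/-- The projector `P_j^{(α)} = |φ_j^{(α)}⟩⟨φ_j^{(α)}|`. -/
def Eigendecomposition.proj (E : Eigendecomposition ρ S) (α : Fin 3) (j : Fin 16) :
    Matrix (Fin 16) (Fin 16) ℂ :=
  Matrix.vecMulVec (E.vec α j).ofLp (star (E.vec α j).ofLp)

/-- The term `H_{jk}^{(α)} = P_j^{(α)} ⊗ (i λ_j^{(α)} / 2h) S_k^{(α)}`. -/
def Eigendecomposition.term (E : Eigendecomposition ρ S) {n : ℕ} (h : ℝ)
    (α : Fin 3) (j : Fin 16) (k : Fin n) :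
    Matrix (Qubit n → Fin 2) (Qubit n → Fin 2) ℂ :=
  onRegisters (E.proj α j) ((Complex.I * (E.val α j : ℂ) / (2 * (h : ℂ))) • shiftTerm α k)

/-- The factors `e^{-i H_{jk}^{(α)} t}`, in increasing lexicographic order of `(α, j, k)`. -/
def Eigendecomposition.factors (E : Eigendecomposition ρ S) (n : ℕ) (h t : ℝ) :
    List (Matrix (Qubit n → Fin 2) (Qubit n → Fin 2) ℂ) :=
  (List.finRange 3).flatMap fun α =>
    (List.finRange 16).flatMap fun j =>
      (List.finRange n).map fun k => evolution (E.term h α j k) t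

/-- One step of the symmetric second-order Trotter formula: the factors for time `τ / 2`,
multiplied in decreasing order, times the same factors in increasing order. -/
def Eigendecomposition.trotter2 (E : Eigendecomposition ρ S) (n : ℕ) (h τ : ℝ) :
    Matrix (Qubit n → Fin 2) (Qubit n → Fin 2) ℂ :=
  (E.factors n h (τ / 2)).reverse.prod * (E.factors n h (τ / 2)).prod

/-- The CNOT bound
`2880^{3/2} T^{3/2} / (h^{3/2} ε^{1/2}) ρ^{-3/4} ‖S⁻¹‖^{3/4} n^{3/2} (432 n² + 378)`,
with the spectral norm of `S⁻¹`. -/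
def cnotBound (n : ℕ) (h ρ : ℝ) (S : Matrix (Fin 6) (Fin 6) ℝ) (T ε : ℝ) : ℝ :=
  (2880 : ℝ) ^ (3 / 2 : ℝ) * T ^ (3 / 2 : ℝ) / (h ^ (3 / 2 : ℝ) * ε ^ (1 / 2 : ℝ)) *
    ρ ^ (-(3 / 4) : ℝ) * ‖S⁻¹‖ ^ (3 / 4 : ℝ) * (n : ℝ) ^ (3 / 2 : ℝ) *
    (432 * (n : ℝ) ^ 2 + 378)

end

end ElasticWave

/-! The proof has three parts: an error bound for one Trotter step, a CNOT count for one step, and a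
choice of the number of steps.

Both rest on one simplification. For fixed `α` the projectors onto the eigenvectors are mutually
orthogonal, so terms with different `j` multiply to zero and commute. The 16 factors with the same
`α` and `k` therefore merge into one exponential of `axisTerm`, that is, of `B_cell^{-1/2} A^{(α)}
B_cell^{-1/2} ⊗ (i/2h) S_k` (`Eigendecomposition.trotter2_eq`). A step is thus a palindromic product
of only `3n` exponentials in each half, whatever eigenbasis was chosen.

Error. Expansions to second order are multiplied with the series of `e^a` as majorant (`IsJet`). The
palindrome and the exponential of the sum agree through the quadratic term, so with `a` the sum of
the norms the error is at most `2a³` when `a ≤ 1`; for larger `a` unitarity alone gives `2 ≤ 2a³`.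
No commutators are estimated. Each merged term has norm at most `w/h` with `w = ρ^{-1/2}
‖S⁻¹‖^{1/2}`, because `A^{(α)}` has norm at most one and `S_k` has eigenvalues in `{0, i, -i}`.
Telescoping over `m` steps gives `54 (n w T / h)³ / m²`.

Cost. Adding bit `k` to the lower bits turns `S_k` into `iY` on bit `k`, conditioned on all lower
bits being set (`onRegisters_diagonal_shiftTerm`). In the eigenbasis of the state register each
exponential is then a `Z` rotation whose angle depends on the four state qubits, with that same
condition. The condition is implemented by a multiply controlled flip that borrows qubits of another
axis, so no ancillas appear. A change of eigenbasis is an arbitrary four-qubit unitary, built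
recursively from the cosine-sine decomposition with 210 CNOTs. One step costs at most `198n² + 162n
+ 1260`, which fits in the budget `2(432n² + 378)` for `n ≥ 1`.

Finally `m` is taken of order `(n w T / h)^{3/2} ε^{-1/2}` (`exists_steps`); the factor `2880^{3/2}`
leaves ample room. -/

namespace ElasticWave

noncomputable section

/-! ### Second-order expansions of products of exponentials -/

/-- The remainder of the exponential series after the quadratic term. -/
def expTail (a : ℝ) : ℝ := Real.exp a - 1 - a - a ^ 2 / 2

/-- `P = 1 + p₁ + p₂ + …`, where the terms are majorized by those of the series of `e ^ a`. -/
structure IsJet {𝔸 : Type*} [NormedRing 𝔸] (P p₁ p₂ : 𝔸) (a : ℝ) : Prop where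
  nonneg : 0 ≤ a
  norm_fst : ‖p₁‖ ≤ a
  norm_snd : ‖p₂‖ ≤ a ^ 2 / 2
  norm_sub : ‖P - 1 - p₁ - p₂‖ ≤ expTail a

theorem expTail_le_cube {a : ℝ} (h0 : 0 ≤ a) (h1 : a ≤ 1) : expTail a ≤ a ^ 3 := by
  have h := Real.exp_bound' h0 h1 (n := 3) (by norm_num)
  simp only [Finset.sum_range_succ, Finset.sum_range_zero, Nat.factorial] at h
  unfold expTail
  norm_num at h
  nlinarith [pow_nonneg h0 3]

theorem expTail_eq_tsum (a : ℝ) :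
    HasSum (fun k : ℕ => a ^ (k + 3) / (k + 3).factorial) (expTail a) := by
  have h := NormedSpace.expSeries_div_hasSum_exp (𝔸 := ℝ) a
  rw [← Real.exp_eq_exp_ℝ] at h
  rw [← hasSum_nat_add_iff' 3] at h
  have h2 : expTail a = Real.exp a - ∑ i ∈ Finset.range 3, a ^ i / i.factorial := by
    simp [Finset.sum_range_succ, expTail]
    ring
  exact h2 ▸ h

theorem norm_exp_sub_le_expTail {𝔸 : Type*} [NormedRing 𝔸] [NormedAlgebra ℂ 𝔸] [CompleteSpace 𝔸]
    (x : 𝔸) : ‖NormedSpace.exp x - 1 - x - (2⁻¹ : ℂ) • x ^ 2‖ ≤ expTail ‖x‖ := by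
  have h := NormedSpace.exp_series_hasSum_exp' (𝕂 := ℂ) x
  rw [← hasSum_nat_add_iff' 3] at h
  have h2 : NormedSpace.exp x - ∑ i ∈ Finset.range 3, ((i.factorial : ℂ)⁻¹) • x ^ i =
      NormedSpace.exp x - 1 - x - (2⁻¹ : ℂ) • x ^ 2 := by
    simp [Finset.sum_range_succ]
    abel
  rw [h2] at h
  rw [← h.tsum_eq]
  refine tsum_of_norm_bounded (expTail_eq_tsum ‖x‖) fun k => ?_
  rw [norm_smul, norm_inv, div_eq_inv_mul]
  have : ‖((k + 3).factorial : ℂ)‖ = (k + 3).factorial := by simp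
  rw [this]
  gcongr
  exact norm_pow_le' x (by omega)

section

variable {𝔸 : Type*} [NormedRing 𝔸]

theorem IsJet.one : IsJet (1 : 𝔸) 0 0 0 :=
  ⟨le_rfl, by simp, by simp, by simp [expTail]⟩

/-- Multiplicativity of the majorant: every term of the remainder of the product is bounded by the
matching term of `e^a e^b = e^{a+b}`. The first- and second-order parts are those of the product of
the two polynomials. -/
theorem IsJet.mul [NormOneClass 𝔸] {P p₁ p₂ Q q₁ q₂ : 𝔸} {a b : ℝ} (hP : IsJet P p₁ p₂ a)
    (hQ : IsJet Q q₁ q₂ b) :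
    IsJet (P * Q) (p₁ + q₁) (p₂ + p₁ * q₁ + q₂) (a + b) := by
  obtain ⟨ha, hp1, hp2, hp⟩ := hP
  obtain ⟨hb, hq1, hq2, hq⟩ := hQ
  refine ⟨by positivity, (norm_add_le _ _).trans (by gcongr), ?_, ?_⟩
  · calc ‖p₂ + p₁ * q₁ + q₂‖ ≤ ‖p₂‖ + ‖p₁‖ * ‖q₁‖ + ‖q₂‖ :=
          (norm_add₃_le).trans (by gcongr; exact norm_mul_le _ _)
      _ ≤ a ^ 2 / 2 + a * b + b ^ 2 / 2 := by gcongr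
      _ = _ := by ring
  · have hQn : ‖Q‖ ≤ Real.exp b := by
      have : Q = 1 + q₁ + q₂ + (Q - 1 - q₁ - q₂) := by abel
      rw [this]
      calc _ ≤ ‖(1 : 𝔸)‖ + ‖q₁‖ + ‖q₂‖ + ‖Q - 1 - q₁ - q₂‖ := norm_add₄_le
        _ ≤ 1 + b + b ^ 2 / 2 + expTail b := by
          rw [norm_one]; gcongr
        _ = _ := by unfold expTail; ring
    have hjn : ‖1 + p₁ + p₂‖ ≤ 1 + a + a ^ 2 / 2 :=
      (norm_add₃_le).trans (by rw [norm_one]; gcongr)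
    have h0 : 0 ≤ expTail a := (norm_nonneg _).trans hp
    have key : P * Q - 1 - (p₁ + q₁) - (p₂ + p₁ * q₁ + q₂) =
        (P - 1 - p₁ - p₂) * Q + (1 + p₁ + p₂) * (Q - 1 - q₁ - q₂) +
          (p₁ * q₂ + p₂ * q₁ + p₂ * q₂) := by noncomm_ring
    rw [key]
    calc _ ≤ ‖P - 1 - p₁ - p₂‖ * ‖Q‖ + ‖1 + p₁ + p₂‖ * ‖Q - 1 - q₁ - q₂‖ +
          (‖p₁‖ * ‖q₂‖ + ‖p₂‖ * ‖q₁‖ + ‖p₂‖ * ‖q₂‖) := by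
          refine (norm_add₃_le).trans ?_
          gcongr
          · exact norm_mul_le _ _
          · exact norm_mul_le _ _
          · refine (norm_add₃_le).trans ?_
            gcongr <;> exact norm_mul_le _ _
      _ ≤ expTail a * Real.exp b + (1 + a + a ^ 2 / 2) * expTail b +
          (a * (b ^ 2 / 2) + a ^ 2 / 2 * b + a ^ 2 / 2 * (b ^ 2 / 2)) := by gcongr
      _ = _ := by unfold expTail; rw [Real.exp_add]; ring

theorem IsJet.exp [NormedAlgebra ℂ 𝔸] [CompleteSpace 𝔸] (x : 𝔸) :
    IsJet (NormedSpace.exp x) x ((2⁻¹ : ℂ) • x ^ 2) ‖x‖ := by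
  refine ⟨norm_nonneg _, le_rfl, ?_, norm_exp_sub_le_expTail x⟩
  rw [norm_smul, norm_inv, div_eq_inv_mul]
  have : ‖(2 : ℂ)‖ = 2 := by simp
  rw [this]
  gcongr
  exact norm_pow_le' x two_pos

/-- The palindromic product of the exponentials `e ^ {x / 2}` has the same second-order expansion
as the exponential of the sum. -/
theorem IsJet.palindrome [NormOneClass 𝔸] [NormedAlgebra ℂ 𝔸] [CompleteSpace 𝔸] (l : List 𝔸) :
    IsJet ((l.map fun x => NormedSpace.exp ((2⁻¹ : ℂ) • x)).reverse.prod *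
      (l.map fun x => NormedSpace.exp ((2⁻¹ : ℂ) • x)).prod) l.sum ((2⁻¹ : ℂ) • l.sum ^ 2)
      (l.map norm).sum := by
  -- Appending at the end of the list wraps the palindrome in `e^{x/2}` on both sides, since the
  -- reversed product then starts with this factor and the other one ends with it.
  induction l using List.reverseRecOn with
  | nil => simpa using IsJet.one
  | append_singleton l x ih =>
    have hx := IsJet.exp ((2⁻¹ : ℂ) • x)
    have h := (hx.mul ih).mul hx
    convert h using 1
    · simp [mul_assoc]
    · simp only [List.sum_append, List.sum_cons, List.sum_nil, add_zero]
      have : x = (2⁻¹ : ℂ) • x + (2⁻¹ : ℂ) • x := by rw [← add_smul]; norm_num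
      nth_rw 1 [this]; abel
    · simp only [List.sum_append, List.sum_cons, List.sum_nil, add_zero]
      simp only [pow_two, mul_add, add_mul, smul_mul_assoc, mul_smul_comm, smul_add, smul_smul]
      module
    · simp only [List.map_append, List.map_cons, List.map_nil, List.sum_append, List.sum_cons,
        List.sum_nil, add_zero, norm_smul, norm_inv]
      have : ‖(2 : ℂ)‖ = 2 := by simp
      rw [this]; ring

theorem norm_list_sum_le' (l : List 𝔸) : ‖l.sum‖ ≤ (l.map norm).sum := by
  induction l with
  | nil => simp
  | cons x l ih => simpa using (norm_add_le _ _).trans (by gcongr)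

theorem expTail_mono {a b : ℝ} (h0 : 0 ≤ a) (hab : a ≤ b) : expTail a ≤ expTail b :=
  hasSum_le (fun k => by gcongr) (expTail_eq_tsum a) (expTail_eq_tsum b)

/-- The common polynomial of degree two cancels, and what remains is a difference of two tails, each
at most `a ^ 3`. -/
theorem norm_palindrome_sub_exp_le [NormOneClass 𝔸] [NormedAlgebra ℂ 𝔸] [CompleteSpace 𝔸]
    (l : List 𝔸) {a : ℝ} (ha : (l.map norm).sum ≤ a) (ha1 : a ≤ 1) :
    ‖NormedSpace.exp l.sum - (l.map fun x => NormedSpace.exp ((2⁻¹ : ℂ) • x)).reverse.prod *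
      (l.map fun x => NormedSpace.exp ((2⁻¹ : ℂ) • x)).prod‖ ≤ 2 * a ^ 3 := by
  have h1 := IsJet.palindrome l
  have h2 := norm_exp_sub_le_expTail l.sum
  have h3 := norm_list_sum_le' l
  set P := (l.map fun x => NormedSpace.exp ((2⁻¹ : ℂ) • x)).reverse.prod *
      (l.map fun x => NormedSpace.exp ((2⁻¹ : ℂ) • x)).prod
  have h4 : expTail ‖l.sum‖ ≤ a ^ 3 :=
    (expTail_mono (norm_nonneg _) (h3.trans ha)).trans
      (expTail_le_cube ((norm_nonneg _).trans (h3.trans ha)) ha1)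
  have h5 : expTail (l.map norm).sum ≤ a ^ 3 :=
    (expTail_mono h1.nonneg ha).trans (expTail_le_cube (h1.nonneg.trans ha) ha1)
  calc _ = ‖(NormedSpace.exp l.sum - 1 - l.sum - (2⁻¹ : ℂ) • l.sum ^ 2) -
        (P - 1 - l.sum - (2⁻¹ : ℂ) • l.sum ^ 2)‖ := by congr 1; abel
    _ ≤ _ := norm_sub_le _ _
    _ ≤ a ^ 3 + a ^ 3 := add_le_add (h2.trans h4) (h1.norm_sub.trans h5)
    _ = _ := by ring

/-- Telescoping: errors of contractions accumulate at most linearly. -/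
theorem norm_pow_sub_pow_le [NormOneClass 𝔸] {A B : 𝔸} (hA : ‖A‖ ≤ 1) (hB : ‖B‖ ≤ 1) (m : ℕ) :
    ‖A ^ m - B ^ m‖ ≤ m * ‖A - B‖ := by
  induction m with
  | zero => simp
  | succ m ih =>
    have : A ^ (m + 1) - B ^ (m + 1) = A * (A ^ m - B ^ m) + (A - B) * B ^ m := by
      rw [pow_succ' A, pow_succ' B]; noncomm_ring
    rw [this]
    calc _ ≤ ‖A‖ * ‖A ^ m - B ^ m‖ + ‖A - B‖ * ‖B ^ m‖ :=
          (norm_add_le _ _).trans (add_le_add (norm_mul_le _ _) (norm_mul_le _ _))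
      _ ≤ 1 * (m * ‖A - B‖) + ‖A - B‖ * 1 := by
          gcongr
          exact (norm_pow_le B m).trans (pow_le_one₀ (norm_nonneg _) hB)
      _ = _ := by push_cast; ring

end

/-! ### Controlled flips of a bit -/

section

variable {Q : Type*} [DecidableEq Q]

open Classical in
/-- The truth value of `p` as a bit. -/
def propBit (p : Prop) : Fin 2 := if p then 1 else 0

theorem propBit_true : propBit True = 1 := by simp [propBit]

theorem propBit_false : propBit False = 0 := by simp [propBit]

theorem propBit_of {p : Prop} (h : p) : propBit p = 1 := by simp [propBit, h]

theorem propBit_of_not {p : Prop} (h : ¬p) : propBit p = 0 := by simp [propBit, h]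

theorem fin_two_add_add (a b : Fin 2) : a + b + b = a := by
  revert a b; decide

/-- Flip the bit `t` if the condition `p` holds. -/
def ctrlNot (p : (Q → Fin 2) → Prop) (t : Q) (y : Q → Fin 2) : Q → Fin 2 :=
  Function.update y t (y t + propBit (p y))

/-- The condition `p` does not involve the bit `t`. -/
def Ignores (p : (Q → Fin 2) → Prop) (t : Q) : Prop :=
  ∀ y b, p (Function.update y t b) = p y

theorem ctrlNot_of_ne (p : (Q → Fin 2) → Prop) {t r : Q} (h : r ≠ t) (y : Q → Fin 2) :
    ctrlNot p t y r = y r := by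
  simp [ctrlNot, h]

theorem ctrlNot_self (p : (Q → Fin 2) → Prop) (t : Q) (y : Q → Fin 2) :
    ctrlNot p t y t = y t + propBit (p y) := by
  simp [ctrlNot]

theorem Ignores.ctrlNot_eq {p : (Q → Fin 2) → Prop} {t : Q} (h : Ignores p t)
    (p' : (Q → Fin 2) → Prop) (y : Q → Fin 2) : p (ctrlNot p' t y) = p y :=
  h _ _

theorem ctrlNot_involutive {p : (Q → Fin 2) → Prop} {t : Q} (h : Ignores p t) :
    Function.Involutive (ctrlNot p t) := by
  intro y
  funext r
  by_cases hr : r = t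
  · subst hr
    rw [ctrlNot_self, ctrlNot_self, h.ctrlNot_eq, fin_two_add_add]
  · simp [ctrlNot_of_ne _ hr]

theorem ctrlNot_commute {p p' : (Q → Fin 2) → Prop} {t t' : Q} (htt : t ≠ t')
    (h : Ignores p t') (h' : Ignores p' t) :
    Function.Commute (ctrlNot p t) (ctrlNot p' t') := by
  intro y
  funext r
  by_cases hr : r = t
  · subst hr
    rw [ctrlNot_self, ctrlNot_of_ne _ htt, h.ctrlNot_eq, ctrlNot_of_ne _ htt, ctrlNot_self]
  · by_cases hr' : r = t'
    · subst hr'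
      rw [ctrlNot_self, ctrlNot_of_ne _ hr, h'.ctrlNot_eq, ctrlNot_of_ne _ hr, ctrlNot_self]
    · simp [ctrlNot_of_ne _ hr, ctrlNot_of_ne _ hr']

/-- The commutator of two controlled flips. -/
theorem ctrlNot_commutator {c p : (Q → Fin 2) → Prop} {t u : Q} (htu : t ≠ u)
    (hct : Ignores c t) (hcu : Ignores c u) (hpt : Ignores p t) (hpu : Ignores p u) :
    ctrlNot (fun y => c y ∧ y u = 1) t ∘ ctrlNot p u ∘ ctrlNot (fun y => c y ∧ y u = 1) t ∘
      ctrlNot p u = ctrlNot (fun y => c y ∧ p y) t := by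
  -- Applied from right to left, `u` is changed by `p` and later restored. The bit `t` receives `u +
  -- p` in between and `u` at the end, both under the condition `c`; the sum is `p` under the
  -- condition `c`.
  funext y r
  simp only [Function.comp_apply]
  by_cases hr : r = t
  · subst hr
    simp only [ctrlNot_self, ctrlNot_of_ne _ htu, ctrlNot_of_ne _ htu.symm, hct.ctrlNot_eq,
      hcu.ctrlNot_eq, hpt.ctrlNot_eq, hpu.ctrlNot_eq]
    generalize y r = a
    generalize y u = b
    by_cases hc : c y <;> by_cases hp : p y <;>
      simp only [hc, hp, true_and, false_and, and_false, propBit_true, propBit_false] <;>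
      fin_cases a <;> fin_cases b <;> simp [propBit]
  · by_cases hr' : r = u
    · subst hr'
      simp only [ctrlNot_self, ctrlNot_of_ne _ hr, hpt.ctrlNot_eq, hpu.ctrlNot_eq,
        fin_two_add_add]
    · simp [ctrlNot_of_ne _ hr, ctrlNot_of_ne _ hr']

theorem dependsOn_update {β : Type*} {f : (Q → Fin 2) → β} {s : Finset Q} {c : Q}
    (hf : DependsOn f (insert c s : Finset Q)) (b : Fin 2) :
    DependsOn (fun y => f (Function.update y c b)) (s : Set Q) := by
  intro x y h
  refine hf fun i hi => ?_
  by_cases hic : i = c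
  · subst hic; simp
  · rw [Function.update_of_ne hic, Function.update_of_ne hic]
    exact h i (by simpa [hic] using hi)

theorem eq_update_of_dependsOn {β : Type*} {f : (Q → Fin 2) → β} {s : Finset Q} {t : Q}
    (hf : DependsOn f (s : Set Q)) (ht : t ∉ s) (y : Q → Fin 2) (b : Fin 2) :
    f (Function.update y t b) = f y := by
  refine hf fun i hi => ?_
  rw [Function.update_of_ne]
  rintro rfl
  exact ht hi

end

/-! ### Circuit costs -/

section

variable {Q : Type*} [Fintype Q] [DecidableEq Q]

/-- The operator `U` is implemented exactly by a circuit with at most `c` CNOT gates. -/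
def HasCost (U : Matrix (Q → Fin 2) (Q → Fin 2) ℂ) (c : ℕ) : Prop :=
  ∃ C : Circuit Q, C.unitary = U ∧ C.cnotCount ≤ c

variable {U V : Matrix (Q → Fin 2) (Q → Fin 2) ℂ} {a b : ℕ}

theorem HasCost.one : HasCost (1 : Matrix (Q → Fin 2) (Q → Fin 2) ℂ) 0 :=
  ⟨[], by simp [Circuit.unitary], by simp [Circuit.cnotCount]⟩

theorem HasCost.mul (hU : HasCost U a) (hV : HasCost V b) : HasCost (U * V) (a + b) := by
  obtain ⟨C, rfl, hC⟩ := hU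
  obtain ⟨D, rfl, hD⟩ := hV
  refine ⟨C ++ D, by simp [Circuit.unitary], ?_⟩
  simp only [Circuit.cnotCount, List.map_append, List.sum_append] at *
  omega

theorem HasCost.mono (hU : HasCost U a) (h : a ≤ b) : HasCost U b :=
  let ⟨C, h1, h2⟩ := hU
  ⟨C, h1, h2.trans h⟩

theorem HasCost.of_eq (hU : HasCost U a) (hVU : V = U) (hab : a ≤ b) : HasCost V b :=
  hVU ▸ hU.mono hab

theorem HasCost.pow (hU : HasCost U a) (m : ℕ) : HasCost (U ^ m) (m * a) := by
  induction m with
  | zero => simpa using HasCost.one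
  | succ m ih => rw [pow_succ]; exact (ih.mul hU).mono (by rw [Nat.succ_mul])

theorem HasCost.list_prod {ι : Type*} (l : List ι) (F : ι → Matrix (Q → Fin 2) (Q → Fin 2) ℂ)
    (c : ι → ℕ) (h : ∀ i ∈ l, HasCost (F i) (c i)) :
    HasCost (l.map F).prod (l.map c).sum := by
  induction l with
  | nil => simpa using HasCost.one
  | cons i l ih =>
    simp only [List.map_cons, List.prod_cons, List.sum_cons]
    exact (h i (by simp)).mul (ih fun j hj => h j (by simp [hj]))

/-! ### Operators on one qubit controlled by the others -/

/-- The operator which applies `g y` to the qubit `t` of the basis state `y`. -/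
def muxOp (t : Q) (g : (Q → Fin 2) → Matrix (Fin 2) (Fin 2) ℂ) :
    Matrix (Q → Fin 2) (Q → Fin 2) ℂ :=
  Matrix.of fun x y => if x = Function.update y t (x t) then g y (x t) (y t) else 0

theorem sum_ite_update_eq (t : Q) (y : Q → Fin 2) (f : (Q → Fin 2) → ℂ) :
    (∑ z, if z = Function.update y t (z t) then f z else 0) =
      ∑ b, f (Function.update y t b) := by
  rw [← Finset.sum_filter]
  refine Finset.sum_bij' (fun z _ => z t) (fun b _ => Function.update y t b) ?_ ?_ ?_ ?_ ?_
  · simp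
  · simp
  · intro z hz; exact (Finset.mem_filter.1 hz).2.symm
  · simp
  · intro z hz; rw [← (Finset.mem_filter.1 hz).2]

/-- The left factor acts on a state whose bit `t` has already been changed, so its matrix must not
depend on that bit. -/
theorem muxOp_mul (t : Q) (g g' : (Q → Fin 2) → Matrix (Fin 2) (Fin 2) ℂ)
    (hg : ∀ y b, g (Function.update y t b) = g y) :
    muxOp t g * muxOp t g' = muxOp t fun y => g y * g' y := by
  ext x y
  simp only [muxOp, Matrix.mul_apply, Matrix.of_apply]
  simp only [mul_ite, mul_zero]
  rw [sum_ite_update_eq t y fun z =>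
    (if x = Function.update z t (x t) then g z (x t) (z t) else 0) * g' y (z t) (y t)]
  simp only [Function.update_idem, Function.update_self, hg]
  split_ifs <;> simp

theorem unitary_single (t : Q) (u : Matrix.unitaryGroup (Fin 2) ℂ) :
    (Gate.single t u).unitary = muxOp t fun _ => (u : Matrix (Fin 2) (Fin 2) ℂ) := by
  ext x y
  simp only [Gate.unitary, tensorOp, muxOp, Matrix.of_apply]
  split_ifs with h
  · rw [Finset.prod_eq_single t]
    · simp
    · intro r _ hr
      have : x r = y r := by rw [h, Function.update_of_ne hr]
      simp only [hr, if_false, this, Matrix.one_apply_eq]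
    · simp
  · obtain ⟨r, hr⟩ := Function.ne_iff.1 h
    have hrt : r ≠ t := by rintro rfl; simp at hr
    rw [Function.update_of_ne hrt] at hr
    exact Finset.prod_eq_zero (Finset.mem_univ r) (by simp [hrt, hr])

theorem HasCost.single (t : Q) {u : Matrix (Fin 2) (Fin 2) ℂ}
    (hu : u ∈ Matrix.unitaryGroup (Fin 2) ℂ) : HasCost (muxOp t fun _ => u) 0 :=
  ⟨[Gate.single t ⟨u, hu⟩], by simp [Circuit.unitary, unitary_single],
    by simp [Circuit.cnotCount, Gate.cnotCost]⟩

/-- Lets a diagonal operator be combined with one-qubit gates on `t` by multiplying 2 × 2 matrices.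
-/
theorem diagonal_eq_muxOp (t : Q) (d : (Q → Fin 2) → ℂ) :
    Matrix.diagonal d =
      muxOp t fun y => Matrix.diagonal fun b => d (Function.update y t b) := by
  ext x y
  simp only [muxOp, Matrix.of_apply, Matrix.diagonal_apply]
  by_cases hxy : x = y
  · subst hxy; simp
  · by_cases h : x t = y t
    · rw [if_neg hxy, if_neg (by rwa [h, Function.update_eq_self])]
    · simp [hxy, h]

/-! ### Permutations of the basis states -/

/-- The operator which maps the basis state `y` to `f y`. -/
def permOp (f : (Q → Fin 2) → Q → Fin 2) : Matrix (Q → Fin 2) (Q → Fin 2) ℂ :=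
  Matrix.of fun x y => if x = f y then 1 else 0

theorem permOp_mul (f g : (Q → Fin 2) → Q → Fin 2) :
    permOp f * permOp g = permOp (f ∘ g) := by
  ext x y
  simp [permOp, Matrix.mul_apply]

theorem permOp_conj {f : (Q → Fin 2) → Q → Fin 2} (hf : Function.Involutive f)
    (M : Matrix (Q → Fin 2) (Q → Fin 2) ℂ) : permOp f * M * permOp f = M.submatrix f f := by
  ext x y
  simp only [permOp, Matrix.mul_apply, Matrix.of_apply, Matrix.submatrix_apply]
  have h (z : Q → Fin 2) : (∑ w, (if x = f w then (1 : ℂ) else 0) * M w z) = M (f x) z := by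
    rw [Finset.sum_eq_single (f x)]
    · simp [hf x]
    · intro w _ hw
      rw [if_neg, zero_mul]
      rintro rfl
      exact hw (hf w).symm
    · simp
  simp only [h, mul_ite, mul_one, mul_zero, Finset.sum_ite_eq', Finset.mem_univ, if_true]

theorem permOp_conj_diagonal {f : (Q → Fin 2) → Q → Fin 2} (hf : Function.Involutive f)
    (d : (Q → Fin 2) → ℂ) : permOp f * Matrix.diagonal d * permOp f = Matrix.diagonal (d ∘ f) := by
  rw [permOp_conj hf]
  exact Matrix.submatrix_diagonal _ _ hf.injective

theorem permOp_ctrlNot_eq_muxOp {p : (Q → Fin 2) → Prop} [DecidablePred p] {t : Q} :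
    permOp (ctrlNot p t) = muxOp t fun y => if p y then !![0, 1; 1, 0] else 1 := by
  ext x y
  simp only [permOp, muxOp, Matrix.of_apply]
  by_cases h : x = Function.update y t (x t)
  · rw [if_pos h]
    have h1 : (x = ctrlNot p t y) ↔ x t = y t + propBit (p y) := by
      constructor
      · intro h2; rw [h2, ctrlNot_self]
      · intro h2
        rw [h, h2]; rfl
    simp only [h1]
    generalize x t = a
    generalize y t = b
    by_cases hp : p y <;> simp only [hp, if_true, if_false, propBit_true, propBit_false] <;>
      fin_cases a <;> fin_cases b <;> simp
  · rw [if_neg h, if_neg]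
    rintro rfl
    apply h
    rw [ctrlNot_self]; rfl

theorem HasCost.cnot {c t : Q} (h : c ≠ t) : HasCost (permOp (ctrlNot (fun y => y c = 1) t)) 1 := by
  refine ⟨[Gate.cnot c t h], ?_, by simp [Circuit.cnotCount, Gate.cnotCost]⟩
  have : ctrlNot (fun y => y c = 1) t = fun y => Function.update y t (y t + y c) := by
    funext y
    simp only [ctrlNot]
    by_cases h1 : y c = 1
    · rw [propBit_of h1, h1]
    · have : y c = 0 := by omega
      rw [propBit_of_not h1, this]
  simp [Circuit.unitary, Gate.unitary, permOp, this]

theorem HasCost.not (t : Q) : HasCost (permOp (ctrlNot (fun _ => True) t)) 0 := by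
  rw [permOp_ctrlNot_eq_muxOp]
  simp only [if_true]
  refine HasCost.single t ?_
  rw [Matrix.mem_unitaryGroup_iff]
  ext i j
  fin_cases i <;> fin_cases j <;> simp [Matrix.star_eq_conjTranspose, Matrix.mul_apply]

/-! ### Diagonal operators -/

/-- The eigenvalue of the Pauli matrix `Z` on a basis state of a qubit. -/
def zSign (b : Fin 2) : ℝ := if b = 0 then 1 else -1

theorem zSign_add_one (b : Fin 2) : zSign (b + 1) = -zSign b := by
  fin_cases b <;> simp [zSign]

theorem diagonal_phase_mem_unitaryGroup {ι : Type*} [Fintype ι] [DecidableEq ι] (θ : ι → ℝ) :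
    (Matrix.diagonal fun i => Complex.exp (Complex.I * θ i)) ∈ Matrix.unitaryGroup ι ℂ := by
  rw [Matrix.mem_unitaryGroup_iff, Matrix.star_eq_conjTranspose, Matrix.diagonal_conjTranspose,
    Matrix.diagonal_mul_diagonal, ← Matrix.diagonal_one]
  congr 1
  funext i
  simp [← Complex.exp_conj, ← Complex.exp_add]

/-- A rotation about the `Z` axis of the qubit `t`, uniformly controlled by the qubits in `s`. -/
theorem HasCost.muxZ (t : Q) (s : Finset Q) (ht : t ∉ s) (θ : (Q → Fin 2) → ℝ)
    (hθ : DependsOn θ (s : Set Q)) :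
    HasCost (Matrix.diagonal fun y => Complex.exp (Complex.I * ((θ y * zSign (y t) : ℝ) : ℂ)))
      (2 ^ (s.card + 1) - 2) := by
  induction s using Finset.induction_on generalizing θ with
  | empty =>
    rw [diagonal_eq_muxOp t]
    have : ∀ y, θ y = θ 0 := fun y => hθ (by simp)
    simp only [this, Function.update_self]
    exact HasCost.single t (diagonal_phase_mem_unitaryGroup _)
  | insert c s hc ih =>
    have htc : t ≠ c := fun h => ht (by simp [h])
    have hts : t ∉ s := fun h => ht (by simp [h])
    have h0 := dependsOn_update hθ 0
    have h1 := dependsOn_update hθ 1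
    -- The angle is split into the mean and the half-difference of its values at `c = 0` and `c =
    -- 1`. Conjugation by a CNOT from `c` to `t` changes the sign of the second part exactly when
    -- the bit `c` is set. The cost recursion is `f(s+1) = 2 f(s) + 2`.
    have ha := ih hts (fun y => (θ (Function.update y c 0) + θ (Function.update y c 1)) / 2)
      (fun x y h => by simp only [h0 h, h1 h])
    have hbd : DependsOn (fun y => (θ (Function.update y c 0) - θ (Function.update y c 1)) / 2)
      (s : Set Q) := fun x y h => by simp only [h0 h, h1 h]
    have hb := ih hts _ hbd
    have hP := HasCost.cnot (Q := Q) htc.symm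
    have hinv : Function.Involutive (ctrlNot (fun y : Q → Fin 2 => y c = 1) t) :=
      ctrlNot_involutive fun y b => by rw [Function.update_of_ne htc.symm]
    have h := ha.mul ((hP.mul hb).mul hP)
    rw [permOp_conj_diagonal hinv, Matrix.diagonal_mul_diagonal] at h
    refine h.of_eq (congrArg Matrix.diagonal (funext fun y => ?_)) ?_
    · simp only [Function.comp_apply, ← Complex.exp_add, ← mul_add, ← Complex.ofReal_add]
      congr 3
      have h2 : (θ (Function.update (ctrlNot (fun y => y c = 1) t y) c 0) -
          θ (Function.update (ctrlNot (fun y => y c = 1) t y) c 1)) / 2 =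
          (θ (Function.update y c 0) - θ (Function.update y c 1)) / 2 := by
        refine hbd fun i hi => ctrlNot_of_ne _ ?_ y
        rintro rfl
        exact hts hi
      rw [h2, ctrlNot_self]
      by_cases hy : y c = 1
      · have : Function.update y c 1 = y := by rw [← hy, Function.update_eq_self]
        rw [propBit_of hy, zSign_add_one, this]; ring
      · have hy0 : y c = 0 := by omega
        have : Function.update y c 0 = y := by rw [← hy0, Function.update_eq_self]
        rw [propBit_of_not hy, this, add_zero]; ring
    · rw [Finset.card_insert_of_notMem hc, pow_succ 2 (s.card + 1)]
      have : 2 ≤ 2 ^ (s.card + 1) := by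
        rw [pow_succ]; have := Nat.one_le_two_pow (n := s.card); omega
      omega

/-- A diagonal unitary on the qubits in `s`. -/
theorem HasCost.diagonal [Nonempty Q] (s : Finset Q) (θ : (Q → Fin 2) → ℝ)
    (hθ : DependsOn θ (s : Set Q)) :
    HasCost (Matrix.diagonal fun y => Complex.exp (Complex.I * (θ y : ℂ)))
      (2 ^ (s.card + 1) - 2 - 2 * s.card) := by
  induction s using Finset.induction_on generalizing θ with
  | empty =>
    rw [diagonal_eq_muxOp (Classical.arbitrary Q)]
    have : ∀ y, θ y = θ 0 := fun y => hθ (by simp)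
    simp only [this]
    exact HasCost.single _ (diagonal_phase_mem_unitaryGroup fun _ => θ 0)
  | insert c s hc ih =>
    have h0 := dependsOn_update hθ 0
    have h1 := dependsOn_update hθ 1
    -- A phase depending on the bit `c` is its mean, which does not involve `c`, plus the
    -- half-difference times the `Z` sign of `c`; the latter is a multiplexed rotation of `c`
    -- itself.
    have ha := ih (fun y => (θ (Function.update y c 0) + θ (Function.update y c 1)) / 2)
      (fun x y h => by simp only [h0 h, h1 h])
    have hb := HasCost.muxZ c s hc
      (fun y => (θ (Function.update y c 0) - θ (Function.update y c 1)) / 2)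
      fun x y h => by simp only [h0 h, h1 h]
    have h := ha.mul hb
    rw [Matrix.diagonal_mul_diagonal] at h
    refine h.of_eq (congrArg Matrix.diagonal (funext fun y => ?_)) (le_of_eq ?_)
    · simp only [← Complex.exp_add, ← mul_add, ← Complex.ofReal_add]
      congr 3
      by_cases hy : y c = 1
      · have : Function.update y c 1 = y := by rw [← hy, Function.update_eq_self]
        rw [hy, this]; simp [zSign]; ring
      · have hy0 : y c = 0 := by omega
        have : Function.update y c 0 = y := by rw [← hy0, Function.update_eq_self]
        rw [hy0, this]; simp [zSign]; ring
    · rw [Finset.card_insert_of_notMem hc, pow_succ 2 (s.card + 1)]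
      have : s.card + 1 ≤ 2 ^ s.card := Nat.lt_two_pow_self
      rw [pow_succ]; omega

end

/-! ### Multiply controlled flips -/

section

variable {Q : Type*} [Fintype Q] [DecidableEq Q]

/-- The Hadamard matrix. -/
def hadamard : Matrix (Fin 2) (Fin 2) ℂ := ((√2 : ℝ) : ℂ)⁻¹ • !![1, 1; 1, -1]

theorem sqrt_two_inv_mul_self : ((√2 : ℝ) : ℂ)⁻¹ * ((√2 : ℝ) : ℂ)⁻¹ = 2⁻¹ := by
  rw [← mul_inv, ← Complex.ofReal_mul, Real.mul_self_sqrt (by norm_num)]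
  norm_num

theorem hadamard_mul_diagonal_mul (a b : ℂ) :
    hadamard * Matrix.diagonal ![a, b] * hadamard =
      !![(a + b) / 2, (a - b) / 2; (a - b) / 2, (a + b) / 2] := by
  simp only [hadamard, Matrix.smul_mul, Matrix.mul_smul, smul_smul, sqrt_two_inv_mul_self]
  have h : Matrix.diagonal ![a, b] = !![a, 0; 0, b] := by
    ext i j; fin_cases i <;> fin_cases j <;> simp
  rw [h, Matrix.mul_fin_two, Matrix.mul_fin_two]
  ext i j
  fin_cases i <;> fin_cases j <;> simp <;> ring

theorem hadamard_mem_unitaryGroup : hadamard ∈ Matrix.unitaryGroup (Fin 2) ℂ := by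
  have h1 : star hadamard = hadamard := by
    ext i j
    fin_cases i <;> fin_cases j <;>
      simp [hadamard, Matrix.star_apply]
  have h2 := hadamard_mul_diagonal_mul 1 1
  have h3 : Matrix.diagonal ![(1 : ℂ), 1] = 1 := by
    ext i j; fin_cases i <;> fin_cases j <;> simp
  rw [h3, mul_one] at h2
  rw [Matrix.mem_unitaryGroup_iff, h1, h2]
  ext i j
  fin_cases i <;> fin_cases j <;> simp

/-- The doubly controlled flip (Toffoli gate). -/
theorem HasCost.toffoli {a b t : Q} (hab : a ≠ b) (ha : a ≠ t) (hb : b ≠ t) :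
    HasCost (permOp (ctrlNot (fun y => y a = 1 ∧ y b = 1) t)) 8 := by
  classical
  have : Nonempty Q := ⟨t⟩
  have hH := HasCost.single t hadamard_mem_unitaryGroup
  -- The doubly controlled `Z` is a diagonal operator on three qubits, costing `2 ^ 4 - 2 - 6 = 8`;
  -- Hadamard gates on `t` turn it into the doubly controlled flip.
  have hD := HasCost.diagonal ({a, b, t} : Finset Q)
    (fun y => if y a = 1 ∧ y b = 1 ∧ y t = 1 then Real.pi else 0) (by
      intro x y h
      simp only [h a (by simp), h b (by simp), h t (by simp)])
  have hc : ({a, b, t} : Finset Q).card = 3 := by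
    rw [Finset.card_insert_of_notMem (by simp [hab, ha]),
      Finset.card_insert_of_notMem (by simp [hb])]
    simp
  rw [hc, diagonal_eq_muxOp t] at hD
  have h := (hH.mul hD).mul hH
  rw [muxOp_mul _ _ _ (by simp), muxOp_mul _ _ _ (by
    intro y b; simp only [Function.update_idem])] at h
  refine h.of_eq ?_ (by norm_num)
  rw [permOp_ctrlNot_eq_muxOp]
  congr 1
  funext y
  simp only [Function.update_of_ne ha, Function.update_of_ne hb, Function.update_self]
  have hd : (Matrix.diagonal fun c : Fin 2 => Complex.exp (Complex.I *
      ((if y a = 1 ∧ y b = 1 ∧ c = 1 then Real.pi else 0 : ℝ) : ℂ))) =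
      Matrix.diagonal ![1, if y a = 1 ∧ y b = 1 then -1 else 1] := by
    congr 1
    funext c
    fin_cases c
    · simp
    · by_cases h1 : y a = 1 ∧ y b = 1
      · simp [h1, mul_comm Complex.I]
      · have : ¬(y a = 1 ∧ y b = 1 ∧ (1 : Fin 2) = 1) := by tauto
        simp [h1]
  rw [hd, hadamard_mul_diagonal_mul]
  split_ifs
  · norm_num
  · ext i j; fin_cases i <;> fin_cases j <;> simp

/-! ### Multiply controlled flips with borrowed qubits. -/

section chain

variable (x q : ℕ → Q)

/-- All the bits `x i`, `i ≤ j`, are set. -/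
def AllSet (j : ℕ) (y : Q → Fin 2) : Prop := ∀ i ≤ j, y (x i) = 1

/-- The product of the flips of `q i` controlled by `x 0, …, x i`, for `i ≤ j`. -/
def flipChain : ℕ → (Q → Fin 2) → Q → Fin 2
  | 0 => ctrlNot (AllSet x 0) (q 0)
  | j + 1 => ctrlNot (AllSet x (j + 1)) (q (j + 1)) ∘ flipChain j

variable {x q} {N : ℕ}

theorem ignores_allSet {j : ℕ} {t : Q} (h : ∀ i ≤ j, x i ≠ t) : Ignores (AllSet x j) t := by
  intro y b
  simp only [AllSet, eq_iff_iff]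
  refine forall₂_congr fun i hi => ?_
  rw [Function.update_of_ne (h i hi)]

theorem flipChain_commute (p : (Q → Fin 2) → Prop) (t : Q)
    {j : ℕ} (ht : ∀ i ≤ j, t ≠ q i) (hp : ∀ i ≤ j, Ignores p (q i))
    (hxt : ∀ i ≤ j, x i ≠ t) : Function.Commute (ctrlNot p t) (flipChain x q j) := by
  induction j with
  | zero => exact ctrlNot_commute (ht 0 le_rfl) (hp 0 le_rfl) (ignores_allSet hxt)
  | succ j ih =>
    exact (ctrlNot_commute (ht _ le_rfl) (hp _ le_rfl) (ignores_allSet hxt)).comp_right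
      (ih (fun i hi => ht i (by omega)) (fun i hi => hp i (by omega))
        fun i hi => hxt i (by omega))

/-- The factors are commuting involutions: controls and targets are disjoint. -/
theorem flipChain_involutive (hxq : ∀ i ≤ N, ∀ l ≤ N, x i ≠ q l)
    (hqq : ∀ i ≤ N, ∀ l ≤ N, i ≠ l → q i ≠ q l) {j : ℕ} (hj : j ≤ N) :
    Function.Involutive (flipChain x q j) := by
  induction j with
  | zero => exact ctrlNot_involutive (ignores_allSet fun i hi => hxq i (by omega) 0 (by omega))
  | succ j ih =>
    intro y
    have hc := flipChain_commute (j := j) (AllSet x (j + 1)) (q (j + 1))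
      (fun i hi => hqq _ hj _ (by omega) (by omega))
      (fun i hi => ignores_allSet fun l hl => hxq l (by omega) i (by omega))
      (fun i hi => hxq i (by omega) _ hj)
    simp only [flipChain, Function.comp_apply]
    rw [hc.eq, ctrlNot_involutive (ignores_allSet fun i hi => hxq i (by omega) _ hj),
      ih (by omega)]

/-- The Toffoli gate from `x (j + 1)` and `q j` to `q (j + 1)` commutes with every flip of the chain
except the one of `q j`. For that one, `ctrlNot_commutator` shows that conjugation creates precisely
the next flip. Only two Toffoli gates are spent on each extra control. -/
theorem flipChain_succ_eq (hxq : ∀ i ≤ N, ∀ l ≤ N, x i ≠ q l)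
    (hqq : ∀ i ≤ N, ∀ l ≤ N, i ≠ l → q i ≠ q l) {j : ℕ} (hj : j + 1 ≤ N) :
    flipChain x q (j + 1) = ctrlNot (fun y => y (x (j + 1)) = 1 ∧ y (q j) = 1) (q (j + 1)) ∘
      flipChain x q j ∘ ctrlNot (fun y => y (x (j + 1)) = 1 ∧ y (q j) = 1) (q (j + 1)) := by
  have hx1 : ∀ l ≤ N, Ignores (fun y : Q → Fin 2 => y (x (j + 1)) = 1) (q l) := fun l hl y b => by
    simp only [Function.update_of_ne (hxq _ hj l hl)]
  have hAj : ∀ l ≤ N, Ignores (AllSet x j) (q l) := fun l hl =>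
    ignores_allSet fun i hi => hxq i (by omega) l hl
  have hcomm := ctrlNot_commutator (hqq _ hj j (by omega) (by omega)) (hx1 _ hj)
    (hx1 j (by omega)) (hAj _ hj) (hAj j (by omega))
  have hAll : (fun y => y (x (j + 1)) = 1 ∧ AllSet x j y) = AllSet x (j + 1) := by
    funext y
    simp only [AllSet, eq_iff_iff]
    constructor
    · rintro ⟨h1, h2⟩ i hi
      rcases Nat.lt_or_ge i (j + 1) with h | h
      · exact h2 i (by omega)
      · rw [le_antisymm hi h]; exact h1
    · exact fun h => ⟨h _ le_rfl, fun i hi => h i (by omega)⟩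
  rw [hAll] at hcomm
  set T := ctrlNot (fun y => y (x (j + 1)) = 1 ∧ y (q j) = 1) (q (j + 1)) with hT
  have hF : Function.Involutive (ctrlNot (AllSet x j) (q j)) := ctrlNot_involutive (hAj j (by omega))
  have hTI : T ∘ ctrlNot (AllSet x j) (q j) ∘ T =
      ctrlNot (AllSet x (j + 1)) (q (j + 1)) ∘ ctrlNot (AllSet x j) (q j) := by
    rw [← hcomm]
    funext y
    simp only [Function.comp_apply, hF y]
  have hpre : ∀ k, k < j → Function.Commute T (flipChain x q k) := fun k hk =>
    flipChain_commute _ _ (fun i hi => hqq _ hj _ (by omega) (by omega))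
      (fun i hi y b => by
        simp only [Function.update_of_ne (hxq _ hj i (by omega)),
          Function.update_of_ne (hqq j (by omega) i (by omega) (by omega))])
      (fun i hi => hxq i (by omega) _ hj)
  cases j with
  | zero => exact hTI.symm
  | succ k =>
    have h1 := hpre k (by omega)
    show _ ∘ ctrlNot _ _ ∘ flipChain x q k = T ∘ (ctrlNot _ _ ∘ flipChain x q k) ∘ T
    funext y
    have h2 := congrFun hTI (flipChain x q k y)
    simp only [Function.comp_apply] at h2 ⊢
    rw [← h1.eq, h2]

theorem HasCost.flipChain (hxq : ∀ i ≤ N, ∀ l ≤ N, x i ≠ q l)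
    (hqq : ∀ i ≤ N, ∀ l ≤ N, i ≠ l → q i ≠ q l) {j : ℕ} (hj : j ≤ N) :
    HasCost (permOp (flipChain x q j)) (16 * j + 1) := by
  induction j with
  | zero =>
    refine (HasCost.cnot (hxq 0 hj 0 hj)).of_eq ?_ le_rfl
    have : AllSet x 0 = fun y => y (x 0) = 1 := by
      funext y
      simp [AllSet]
    simp only [ElasticWave.flipChain, this]
  | succ j ih =>
    have hT := HasCost.toffoli (hxq (j + 1) hj j (by omega)) (hxq (j + 1) hj (j + 1) hj)
      (hqq j (by omega) (j + 1) hj (by omega))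
    refine ((hT.mul (ih (by omega))).mul hT).of_eq ?_ (by omega)
    rw [flipChain_succ_eq hxq hqq hj, permOp_mul, permOp_mul]
    rfl

/-- A flip with `j + 1` controls, using `j` other qubits in arbitrary states. -/
theorem HasCost.multiControlled (hxq : ∀ i ≤ N, ∀ l ≤ N, x i ≠ q l)
    (hqq : ∀ i ≤ N, ∀ l ≤ N, i ≠ l → q i ≠ q l) {j : ℕ} (hj : j ≤ N) :
    HasCost (permOp (ctrlNot (AllSet x j) (q j))) (32 * (j + 1)) := by
  cases j with
  | zero => exact (HasCost.flipChain hxq hqq hj).mono (by omega)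
  | succ j =>
    -- The shorter chain is its own inverse and undoes all flips of the longer one but the last, so
    -- the borrowed qubits `q 0, …, q j` are restored whatever their state was.
    refine ((HasCost.flipChain hxq hqq hj).mul
      (HasCost.flipChain (j := j) hxq hqq (by omega))).of_eq ?_ (by omega)
    rw [permOp_mul]
    congr 1
    funext y
    simp only [Function.comp_apply, ElasticWave.flipChain,
      flipChain_involutive hxq hqq (show j ≤ N by omega) y]

end chain

open Classical in
/-- A controlled rotation about the `Z` axis of the qubit `t`, from a controlled flip and two
rotations without the control. -/
theorem HasCost.controlledMuxZ {p : (Q → Fin 2) → Prop} {t : Q} {c : ℕ} (hp : Ignores p t)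
    (hc : HasCost (permOp (ctrlNot p t)) c) {s : Finset Q} (ht : t ∉ s) (θ : (Q → Fin 2) → ℝ)
    (hθ : DependsOn θ (s : Set Q)) :
    HasCost (Matrix.diagonal fun y => Complex.exp (Complex.I *
        (((if p y then θ y else 0) * zSign (y t) : ℝ) : ℂ)))
      (2 * (2 ^ (s.card + 1) - 2) + 2 * c) := by
  -- Rotations by `θ / 2` and `-θ / 2` cancel unless the flips around the second one reverse its
  -- sign.
  have h1 := HasCost.muxZ t s ht (fun y => θ y / 2) fun x y h => by simp only [hθ h]
  have hd : DependsOn (fun y => -(θ y / 2)) (s : Set Q) := fun x y h => by simp only [hθ h]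
  have h2 := HasCost.muxZ t s ht _ hd
  have h := h1.mul ((hc.mul h2).mul hc)
  rw [permOp_conj_diagonal (ctrlNot_involutive hp), Matrix.diagonal_mul_diagonal] at h
  refine h.of_eq (congrArg Matrix.diagonal (funext fun y => ?_)) (by omega)
  simp only [Function.comp_apply, ← Complex.exp_add, ← mul_add, ← Complex.ofReal_add]
  congr 3
  have h3 : θ (ctrlNot p t y) = θ y := eq_update_of_dependsOn hθ ht y _
  rw [h3, ctrlNot_self]
  by_cases hy : p y
  · rw [propBit_of hy, zSign_add_one, if_pos hy]; ring
  · rw [propBit_of_not hy, add_zero, if_neg hy]; ring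

end

/-! ### Decompositions of unitary matrices -/

section

open Matrix

variable {ι : Type*} [Fintype ι] [DecidableEq ι]

/-- The argument is applied to `X` by functional calculus. The branch cut does no harm, since every
function is continuous on the finite spectrum. The Hermitian logarithm reduces the diagonalization
of unitary matrices to the Hermitian spectral theorem. -/
theorem exists_isHermitian_exp_eq {X : Matrix ι ι ℂ} (hX : X ∈ unitaryGroup ι ℂ) :
    ∃ H : Matrix ι ι ℂ, H.IsHermitian ∧ NormedSpace.exp (Complex.I • H) = X := by
  have hn : IsStarNormal X := ⟨by
    rw [Commute, SemiconjBy, mem_unitaryGroup_iff.1 hX, mem_unitaryGroup_iff'.1 hX]⟩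
  have hfin := X.finite_spectrum
  refine ⟨cfc (fun z => (Complex.arg z : ℂ)) X, ?_, ?_⟩
  · exact IsSelfAdjoint.cfc_arg X
  · rw [← cfc_smul Complex.I _ X (hfin.continuousOn _), ← CFC.complex_exp_eq_normedSpace_exp,
      ← cfc_comp' Complex.exp _ X Complex.continuous_exp.continuousOn (hfin.continuousOn _)]
    conv_rhs => rw [← cfc_id' ℂ X]
    refine cfc_congr fun z hz => ?_
    have h1 : ‖z‖ = 1 := spectrum.norm_eq_one_of_unitary hX hz
    have h2 := Complex.norm_mul_exp_arg_mul_I z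
    rw [h1, Complex.ofReal_one, one_mul] at h2
    simpa [mul_comm] using h2

theorem exp_mul_diagonal_mul {V W : Matrix ι ι ℂ} (hVW : V * W = 1) (d : ι → ℂ) :
    NormedSpace.exp (V * diagonal d * W) = V * diagonal (fun i => Complex.exp (d i)) * W := by
  have hinv : V⁻¹ = W := inv_eq_right_inv hVW
  have hu : IsUnit V := ⟨⟨V, W, hVW, mul_eq_one_comm.1 hVW⟩, rfl⟩
  rw [← hinv, exp_conj _ _ hu, exp_diagonal]
  congr 3
  funext i
  rw [Pi.coe_exp, Complex.exp_eq_exp_ℂ]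

theorem exists_unitary_conj_diagonal {X : Matrix ι ι ℂ} (hX : X ∈ unitaryGroup ι ℂ) :
    ∃ V ∈ unitaryGroup ι ℂ, ∃ θ : ι → ℝ,
      X = V * diagonal (fun i => Complex.exp (Complex.I * θ i)) * star V := by
  obtain ⟨H, hH, rfl⟩ := exists_isHermitian_exp_eq hX
  refine ⟨hH.eigenvectorUnitary, hH.eigenvectorUnitary.2, hH.eigenvalues, ?_⟩
  rw [← exp_mul_diagonal_mul (mem_unitaryGroup_iff.1 hH.eigenvectorUnitary.2)]
  congr 1
  conv_lhs => rw [hH.spectral_theorem, Unitary.conjStarAlgAut_apply]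
  rw [← smul_mul_assoc, ← mul_smul_comm, ← diagonal_smul]
  rfl

/-- The rotation `[[cos θ, -sin θ], [sin θ, cos θ]]` with a diagonal matrix of angles. -/
def blockRotation (θ : ι → ℝ) : Matrix (ι ⊕ ι) (ι ⊕ ι) ℂ :=
  fromBlocks (diagonal fun i => (Real.cos (θ i) : ℂ)) (-diagonal fun i => (Real.sin (θ i) : ℂ))
    (diagonal fun i => (Real.sin (θ i) : ℂ)) (diagonal fun i => (Real.cos (θ i) : ℂ))

/-- The matrix `e^{i θ} ⊕ e^{-i θ}`. -/
def blockPhase (θ : ι → ℝ) : Matrix (ι ⊕ ι) (ι ⊕ ι) ℂ :=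
  fromBlocks (diagonal fun i => Complex.exp (Complex.I * θ i)) 0 0
    (diagonal fun i => Complex.exp (Complex.I * (-θ i : ℝ)))

/-- Diagonalize `A * star B = V D² V⁻¹` with `D` a diagonal phase. With `W = D V⁻¹ B` one gets `A =
V D W` and `B = V D⁻¹ W`, so the two blocks differ only by opposite phases. -/
theorem exists_demultiplex {A B : Matrix ι ι ℂ} (hA : A ∈ unitaryGroup ι ℂ)
    (hB : B ∈ unitaryGroup ι ℂ) :
    ∃ V ∈ unitaryGroup ι ℂ, ∃ W ∈ unitaryGroup ι ℂ, ∃ θ : ι → ℝ,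
      fromBlocks A 0 0 B = fromBlocks V 0 0 V * blockPhase θ * fromBlocks W 0 0 W := by
  obtain ⟨V, hV, θ, h⟩ := exists_unitary_conj_diagonal (mul_mem hA (Unitary.star_mem hB))
  set D : Matrix ι ι ℂ := diagonal fun i => Complex.exp (Complex.I * (θ i / 2 : ℝ)) with hD
  set D' : Matrix ι ι ℂ := diagonal fun i => Complex.exp (Complex.I * (-(θ i / 2) : ℝ)) with hD'
  have hDm : D ∈ unitaryGroup ι ℂ := diagonal_phase_mem_unitaryGroup _
  have hD'm : D' ∈ unitaryGroup ι ℂ := diagonal_phase_mem_unitaryGroup _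
  have hDD : D * D = diagonal fun i => Complex.exp (Complex.I * θ i) := by
    rw [hD, diagonal_mul_diagonal]
    congr 1
    funext i
    rw [← Complex.exp_add]
    congr 1
    push_cast; ring
  have hDD' : D' * D = 1 := by
    rw [hD, hD', diagonal_mul_diagonal, ← diagonal_one]
    congr 1
    funext i
    rw [← Complex.exp_add, ← mul_add, ← Complex.ofReal_add]
    simp
  have hD'D : D * D' = 1 := mul_eq_one_comm.1 hDD'
  have hVV : V * star V = 1 := mem_unitaryGroup_iff.1 hV
  have hBB : star B * B = 1 := mem_unitaryGroup_iff'.1 hB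
  refine ⟨V, hV, D * star V * B, mul_mem (mul_mem hDm (Unitary.star_mem hV)) hB, fun i => θ i / 2, ?_⟩
  have e1 : A = V * D * (D * star V * B) := by
    calc A = (A * star B) * B := by rw [mul_assoc, hBB, mul_one]
      _ = _ := by rw [h, ← hDD]; noncomm_ring
  have e2 : B = V * D' * (D * star V * B) := by
    calc B = V * star V * B := by rw [hVV, one_mul]
      _ = V * (D' * D) * star V * B := by rw [hDD', mul_one]
      _ = _ := by noncomm_ring
  rw [blockPhase, fromBlocks_multiply, fromBlocks_multiply]
  simp only [mul_zero, zero_mul, add_zero, zero_add]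
  rw [← e1, ← e2]

/-- The matrix whose columns are the vectors of an orthonormal basis. -/
def basisMatrix (b : OrthonormalBasis ι ℂ (EuclideanSpace ℂ ι)) : Matrix ι ι ℂ :=
  Matrix.of fun i j => b j i

theorem basisMatrix_mem_unitaryGroup (b : OrthonormalBasis ι ℂ (EuclideanSpace ℂ ι)) :
    basisMatrix b ∈ unitaryGroup ι ℂ := by
  rw [mem_unitaryGroup_iff']
  ext i j
  have h := orthonormal_iff_ite.1 b.orthonormal i j
  rw [EuclideanSpace.inner_eq_star_dotProduct, dotProduct] at h
  simpa [basisMatrix, mul_apply, one_apply, mul_comm] using h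

/-- The columns of `G` are orthogonal with norms `|c i|`. Those with `c i ≠ 0` are normalized and
completed to an orthonormal basis; the others vanish, so the completion does not matter. -/
theorem exists_unitary_mul_diagonal {G : Matrix ι ι ℂ} {c : ι → ℝ}
    (h : star G * G = diagonal fun i => ((c i ^ 2 : ℝ) : ℂ)) :
    ∃ P ∈ unitaryGroup ι ℂ, G = P * diagonal fun i => (c i : ℂ) := by
  let w : ι → EuclideanSpace ℂ ι := fun i => WithLp.toLp 2 fun k => G k i
  have hw : ∀ i j, inner ℂ (w i) (w j) = if i = j then ((c i ^ 2 : ℝ) : ℂ) else 0 := by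
    intro i j
    have h1 := congrFun (congrFun h i) j
    rw [diagonal_apply] at h1
    rw [← h1, EuclideanSpace.inner_eq_star_dotProduct]
    simp [w, mul_apply, dotProduct, mul_comm]
  let v : ι → EuclideanSpace ℂ ι := fun i => ((c i : ℂ)⁻¹) • w i
  have hv : Orthonormal ℂ (Set.domRestrict {i | c i ≠ 0} v) := by
    rw [orthonormal_iff_ite]
    rintro ⟨i, hi⟩ ⟨j, hj⟩
    simp only [Set.mem_ofPred_eq] at hi hj
    simp only [Set.domRestrict_apply, v, inner_smul_left, inner_smul_right, hw, Subtype.mk.injEq]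
    split_ifs with hij
    · subst hij
      have : (c i : ℂ) ≠ 0 := by exact_mod_cast hi
      simp only [map_inv₀, Complex.conj_ofReal]
      push_cast
      field_simp
    · simp
  obtain ⟨b, hb⟩ := hv.exists_orthonormalBasis_extension_of_card_eq (by simp)
  refine ⟨basisMatrix b, basisMatrix_mem_unitaryGroup b, ?_⟩
  ext k i
  rw [mul_diagonal]
  by_cases hi : c i = 0
  · have h2 := hw i i
    rw [if_pos rfl, hi] at h2
    have h3 : w i = 0 := by rw [← inner_self_eq_zero (𝕜 := ℂ), h2]; simp
    have h4 : w i k = 0 := by rw [h3]; rfl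
    simpa [hi] using h4
  · have h2 : b i = v i := hb i hi
    have : (c i : ℂ) ≠ 0 := by exact_mod_cast hi
    simp only [basisMatrix, of_apply, h2, v, w, PiLp.smul_apply, smul_eq_mul]
    field_simp

theorem fromBlocks_diagonal_mem_unitaryGroup {A B : Matrix ι ι ℂ} (hA : A ∈ unitaryGroup ι ℂ)
    (hB : B ∈ unitaryGroup ι ℂ) : fromBlocks A 0 0 B ∈ unitaryGroup (ι ⊕ ι) ℂ := by
  rw [mem_unitaryGroup_iff, star_eq_conjTranspose] at *
  rw [fromBlocks_conjTranspose, fromBlocks_multiply]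
  simp [hA, hB]

theorem star_blockRotation (θ : ι → ℝ) : star (blockRotation θ) = blockRotation fun i => -θ i := by
  rw [star_eq_conjTranspose, blockRotation, fromBlocks_conjTranspose, blockRotation]
  simp only [diagonal_conjTranspose, diagonal_neg]
  congr 2 <;> funext i <;> simp [Pi.star_apply, -Complex.ofReal_cos, -Complex.ofReal_sin]

theorem blockRotation_mul_star (θ : ι → ℝ) : blockRotation θ * star (blockRotation θ) = 1 := by
  rw [star_blockRotation, blockRotation, blockRotation, fromBlocks_multiply, ← fromBlocks_one]
  simp only [diagonal_neg, diagonal_mul_diagonal, diagonal_add, ← diagonal_one, ← diagonal_zero]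
  congr 2 <;> funext i <;> simp [← pow_two] <;> ring

open scoped ComplexOrder in
/-- The cosine-sine decomposition. -/
theorem exists_cosineSine {U : Matrix (ι ⊕ ι) (ι ⊕ ι) ℂ} (hU : U ∈ unitaryGroup (ι ⊕ ι) ℂ) :
    ∃ A₁ ∈ unitaryGroup ι ℂ, ∃ A₂ ∈ unitaryGroup ι ℂ, ∃ B₁ ∈ unitaryGroup ι ℂ,
      ∃ B₂ ∈ unitaryGroup ι ℂ, ∃ θ : ι → ℝ,
        U = fromBlocks A₁ 0 0 A₂ * blockRotation θ * fromBlocks B₁ 0 0 B₂ := by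
  obtain ⟨A, B, C, D, rfl⟩ : ∃ A B C D, U = fromBlocks A B C D :=
    ⟨_, _, _, _, (fromBlocks_toBlocks U).symm⟩
  have h1 := mem_unitaryGroup_iff'.1 hU
  rw [star_eq_conjTranspose, fromBlocks_conjTranspose, fromBlocks_multiply, ← fromBlocks_one,
    fromBlocks_inj] at h1
  have hAC : star A * A + star C * C = 1 := h1.1
  have hH : (star A * A).IsHermitian := isHermitian_conjTranspose_mul_self A
  set V : Matrix ι ι ℂ := hH.eigenvectorUnitary.1 with hVdef
  have hV : V ∈ unitaryGroup ι ℂ := hH.eigenvectorUnitary.2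
  have hV1 : star V * V = 1 := mem_unitaryGroup_iff'.1 hV
  have hV2 : V * star V = 1 := mem_unitaryGroup_iff.1 hV
  set lam := hH.eigenvalues with hlam
  have hAV : star (A * V) * (A * V) = diagonal fun i => (lam i : ℂ) := by
    have h2 := hH.spectral_theorem
    rw [Unitary.conjStarAlgAut_apply] at h2
    calc star (A * V) * (A * V) = star V * (star A * A) * V := by rw [star_mul]; noncomm_ring
      _ = star V * (V * diagonal (RCLike.ofReal ∘ lam) * star V) * V := by rw [h2]
      _ = (star V * V) * diagonal (RCLike.ofReal ∘ lam) * (star V * V) := by noncomm_ring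
      _ = _ := by rw [hV1, one_mul, mul_one]; rfl
  -- As `star A * A + star C * C = 1`, the same `V` diagonalizes both Gram matrices, with
  -- eigenvalues adding up to one; hence squares of cosines and sines.
  have hCV : star (C * V) * (C * V) = diagonal fun i => ((1 - lam i : ℝ) : ℂ) := by
    have h2 : star (A * V) * (A * V) + star (C * V) * (C * V) = 1 := by
      calc _ = star V * (star A * A + star C * C) * V := by
            rw [star_mul, star_mul]; noncomm_ring
        _ = 1 := by rw [hAC, mul_one, hV1]
    rw [hAV] at h2
    rw [eq_sub_of_add_eq' h2, ← diagonal_one, diagonal_sub]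
    congr 1
    funext i
    push_cast; rfl
  have hnonneg : ∀ (M : Matrix ι ι ℂ) (d : ι → ℝ), star M * M = diagonal (fun i => (d i : ℂ)) →
      ∀ i, 0 ≤ d i := by
    intro M d h i
    have h2 := congrFun (congrFun h i) i
    rw [diagonal_apply_eq, mul_apply] at h2
    have h3 : ((∑ k, ‖M k i‖ ^ 2 : ℝ) : ℂ) = d i := by
      rw [← h2]
      push_cast
      refine Finset.sum_congr rfl fun k _ => ?_
      rw [star_apply, ← Complex.conj_mul']
      rfl
    rw [← Complex.ofReal_inj.1 h3]
    positivity
  have hl0 := hnonneg _ _ hAV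
  have hl1 := hnonneg _ _ hCV
  set θ : ι → ℝ := fun i => Real.arccos √(lam i) with hθ
  have hcos : ∀ i, Real.cos (θ i) = √(lam i) := fun i =>
    Real.cos_arccos (by linarith [Real.sqrt_nonneg (lam i)])
      (Real.sqrt_le_one.2 (by linarith [hl1 i]))
  have hsin : ∀ i, Real.sin (θ i) = √(1 - lam i) := fun i => by
    rw [hθ, Real.sin_arccos, Real.sq_sqrt (hl0 i)]
  obtain ⟨P, hP, hPA⟩ := exists_unitary_mul_diagonal (G := A * V) (c := fun i => Real.cos (θ i))
    (by rw [hAV]; congr 1; funext i; rw [hcos, Real.sq_sqrt (hl0 i)])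
  obtain ⟨R, hR, hRC⟩ := exists_unitary_mul_diagonal (G := C * V) (c := fun i => Real.sin (θ i))
    (by rw [hCV]; congr 1; funext i; rw [hsin, Real.sq_sqrt (hl1 i)])
  have hRot : blockRotation θ ∈ unitaryGroup (ι ⊕ ι) ℂ :=
    mem_unitaryGroup_iff.2 (blockRotation_mul_star θ)
  have hPR := fromBlocks_diagonal_mem_unitaryGroup hP hR
  have hV' := fromBlocks_diagonal_mem_unitaryGroup hV (one_mem (unitaryGroup ι ℂ))
  set L := fromBlocks P 0 0 R * blockRotation θ with hL
  have hLm : L ∈ unitaryGroup (ι ⊕ ι) ℂ := mul_mem hPR hRot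
  -- The factor `L` already has the correct first block column. The correction `N` is unitary with
  -- first block column that of the identity, and unitarity forces `N` to be block diagonal.
  set N := star L * (fromBlocks A B C D * fromBlocks V 0 0 1) with hN
  have hNm : N ∈ unitaryGroup (ι ⊕ ι) ℂ := mul_mem (Unitary.star_mem hLm) (mul_mem hU hV')
  obtain ⟨N₁, X, N₂, Y, hNb⟩ : ∃ a b c d, N = fromBlocks a b c d :=
    ⟨_, _, _, _, (fromBlocks_toBlocks N).symm⟩
  have hLN : L * N = fromBlocks A B C D * fromBlocks V 0 0 1 := by
    rw [hN, ← mul_assoc, mem_unitaryGroup_iff.1 hLm, one_mul]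
  -- The first block column of `N` is that of the identity.
  have hcol : fromBlocks A B C D * fromBlocks V 0 0 1 * fromBlocks 1 0 0 0 =
      L * fromBlocks 1 0 0 0 := by
    rw [hL, blockRotation]
    simp only [fromBlocks_multiply, mul_zero, zero_mul, mul_one, add_zero, zero_add, hPA, hRC]
  have hNcol : N * fromBlocks 1 0 0 0 = fromBlocks 1 0 0 0 := by
    rw [hN, mul_assoc, hcol, ← mul_assoc, mem_unitaryGroup_iff'.1 hLm, one_mul]
  rw [hNb, fromBlocks_multiply, fromBlocks_inj] at hNcol
  simp only [mul_one, mul_zero, add_zero] at hNcol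
  obtain ⟨rfl, -, rfl, -⟩ := hNcol
  have hNN := mem_unitaryGroup_iff.1 hNm
  rw [hNb, star_eq_conjTranspose, fromBlocks_conjTranspose, fromBlocks_multiply, ← fromBlocks_one,
    fromBlocks_inj] at hNN
  have hX : X = 0 := by
    have := hNN.1
    simp only [conjTranspose_one, mul_one, add_eq_left] at this
    exact self_mul_conjTranspose_eq_zero.1 this
  subst hX
  have hY : Y ∈ unitaryGroup ι ℂ := by
    rw [mem_unitaryGroup_iff]
    simpa [star_eq_conjTranspose] using hNN.2.2.2
  refine ⟨P, hP, R, hR, star V, Unitary.star_mem hV, Y, hY, θ, ?_⟩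
  calc fromBlocks A B C D =
        fromBlocks A B C D * fromBlocks V 0 0 1 * fromBlocks (star V) 0 0 1 := by
        rw [mul_assoc, fromBlocks_multiply]
        simp [hV2]
    _ = L * (fromBlocks 1 0 0 Y * fromBlocks (star V) 0 0 1) := by
        rw [← hLN, hNb, mul_assoc]
    _ = _ := by
        rw [fromBlocks_multiply]
        simp [hL]

end

theorem submatrix_mem_unitaryGroup {ι κ : Type*} [Fintype ι] [DecidableEq ι] [Fintype κ]
    [DecidableEq κ] (e : κ ≃ ι) {U : Matrix ι ι ℂ} (hU : U ∈ Matrix.unitaryGroup ι ℂ) :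
    U.submatrix e e ∈ Matrix.unitaryGroup κ ℂ := by
  rw [Matrix.mem_unitaryGroup_iff, Matrix.star_eq_conjTranspose] at *
  rw [Matrix.conjTranspose_submatrix, Matrix.submatrix_mul_equiv, hU, Matrix.submatrix_one_equiv]

/-! ### Operators on some of the qubits -/

section

open Classical in
/-- The operator `U` on the qubits `ι p`, extended by the identity on the other qubits. -/
def embedOp {P Q : Type*} (ι : P → Q) (U : Matrix (P → Fin 2) (P → Fin 2) ℂ) :
    Matrix (Q → Fin 2) (Q → Fin 2) ℂ :=
  Matrix.of fun x y => if ∀ r, r ∉ Set.range ι → x r = y r then U (x ∘ ι) (y ∘ ι) else 0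

variable {P Q : Type*} [Fintype P] [DecidableEq P] [Fintype Q] [DecidableEq Q] {ι : P → Q}

open Classical in
theorem sum_ite_agree (hι : Function.Injective ι) (y : Q → Fin 2) (f : (P → Fin 2) → ℂ) :
    (∑ z : Q → Fin 2, if ∀ r, r ∉ Set.range ι → z r = y r then f (z ∘ ι) else 0) = ∑ w, f w := by
  rw [← Finset.sum_filter]
  refine Finset.sum_bij' (fun z _ => z ∘ ι) (fun w _ => Function.extend ι w y) ?_ ?_ ?_ ?_ ?_
  · simp
  · intro w _
    simp only [Finset.mem_filter, Finset.mem_univ, true_and]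
    exact fun r hr => Function.extend_apply' _ _ _ (by simpa using hr)
  · intro z hz
    funext r
    by_cases hr : r ∈ Set.range ι
    · obtain ⟨p, rfl⟩ := hr
      rw [hι.extend_apply]; rfl
    · rw [Function.extend_apply' _ _ _ (by simpa using hr), (Finset.mem_filter.1 hz).2 r hr]
  · intro w _
    funext p
    simp [hι.extend_apply]
  · simp

theorem embedOp_mul (hι : Function.Injective ι) (U V : Matrix (P → Fin 2) (P → Fin 2) ℂ) :
    embedOp ι (U * V) = embedOp ι U * embedOp ι V := by
  ext x y
  simp only [embedOp, Matrix.mul_apply, Matrix.of_apply]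
  simp only [mul_ite, mul_zero]
  by_cases h : ∀ r, r ∉ Set.range ι → x r = y r
  · rw [if_pos h, ← sum_ite_agree hι y fun w => U (x ∘ ι) w * V w (y ∘ ι)]
    refine Finset.sum_congr rfl fun z _ => ?_
    by_cases hz : ∀ r, r ∉ Set.range ι → z r = y r
    · rw [if_pos hz, if_pos hz, if_pos fun r hr => (h r hr).trans (hz r hr).symm]
    · rw [if_neg hz, if_neg hz]
  · rw [if_neg h]
    refine (Finset.sum_eq_zero fun z _ => ?_).symm
    by_cases hz : ∀ r, r ∉ Set.range ι → z r = y r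
    · rw [if_pos hz, if_neg fun hx => h fun r hr => (hx r hr).trans (hz r hr), zero_mul]
    · rw [if_neg hz]

theorem agree_iff_eq {x y : Q → Fin 2} :
    ((∀ r, r ∉ Set.range ι → x r = y r) ∧ x ∘ ι = y ∘ ι) ↔ x = y := by
  constructor
  · rintro ⟨h1, h2⟩
    funext r
    by_cases hr : r ∈ Set.range ι
    · obtain ⟨p, rfl⟩ := hr
      exact congrFun h2 p
    · exact h1 r hr
  · rintro rfl; simp

theorem embedOp_diagonal (d : (P → Fin 2) → ℂ) :
    embedOp ι (Matrix.diagonal d) = Matrix.diagonal fun y => d (y ∘ ι) := by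
  ext x y
  simp only [embedOp, Matrix.of_apply, Matrix.diagonal_apply]
  rw [← ite_and]
  by_cases h : x = y
  · rw [if_pos h, if_pos (agree_iff_eq.2 h)]
  · rw [if_neg h, if_neg fun h2 => h (agree_iff_eq.1 h2)]

end

/-! ### Arbitrary unitaries -/

section

/-- Separate the first bit. -/
def splitEquiv (c : ℕ) : (Fin (c + 1) → Fin 2) ≃ (Fin c → Fin 2) ⊕ (Fin c → Fin 2) where
  toFun x := if x 0 = 0 then Sum.inl (Fin.tail x) else Sum.inr (Fin.tail x)
  invFun := Sum.elim (fun w => Fin.cons 0 w) (fun w => Fin.cons 1 w)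
  left_inv x := by
    dsimp only
    split_ifs with h
    · nth_rw 2 [← Fin.cons_self_tail x]; rw [h]; rfl
    · have h1 : x 0 = 1 := by omega
      nth_rw 2 [← Fin.cons_self_tail x]; rw [h1]; rfl
  right_inv w := by
    cases w <;> simp

variable {Q : Type*} [Fintype Q] [DecidableEq Q] {c : ℕ} {ι : Fin (c + 1) → Q}

theorem tail_comp (y : Q → Fin 2) : Fin.tail (y ∘ ι) = y ∘ (ι ∘ Fin.succ) := rfl

/-- Equal blocks mean that the first qubit is untouched, which is what makes the recursion on the
number of qubits possible. -/
theorem embedOp_fromBlocks_same (hι : Function.Injective ι)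
    (V : Matrix (Fin c → Fin 2) (Fin c → Fin 2) ℂ) :
    embedOp ι ((Matrix.fromBlocks V 0 0 V).submatrix (splitEquiv c) (splitEquiv c)) =
      embedOp (ι ∘ Fin.succ) V := by
  ext x y
  simp only [embedOp, Matrix.of_apply, Matrix.submatrix_apply]
  have hr0 : ι 0 ∉ Set.range (ι ∘ Fin.succ) := by
    rintro ⟨i, hi⟩
    exact Fin.succ_ne_zero i (hι hi)
  have hiff : (∀ r, r ∉ Set.range (ι ∘ Fin.succ) → x r = y r) ↔
      (∀ r, r ∉ Set.range ι → x r = y r) ∧ x (ι 0) = y (ι 0) := by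
    constructor
    · refine fun h => ⟨fun r hr => h r ?_, h _ hr0⟩
      rintro ⟨i, hi⟩
      exact hr ⟨_, hi⟩
    · rintro ⟨h1, h2⟩ r hr
      by_cases h : r ∈ Set.range ι
      · obtain ⟨i, rfl⟩ := h
        induction i using Fin.cases with
        | zero => exact h2
        | succ i => exact (hr ⟨i, rfl⟩).elim
      · exact h1 r h
  simp only [hiff, ite_and]
  by_cases h : ∀ r, r ∉ Set.range ι → x r = y r
  · rw [if_pos h, if_pos h]
    by_cases hx : x (ι 0) = 0 <;> by_cases hy : y (ι 0) = 0
    · simp [splitEquiv, hx, hy, tail_comp]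
    · simp [splitEquiv, hx, hy, Ne.symm hy]
    · simp [splitEquiv, hx, hy]
    · have hx1 : x (ι 0) = 1 := by omega
      have hy1 : y (ι 0) = 1 := by omega
      simp [splitEquiv, hx1, hy1, tail_comp]
  · rw [if_neg h, if_neg h]

theorem embedOp_blockPhase (θ : (Fin c → Fin 2) → ℝ) :
    embedOp ι ((blockPhase θ).submatrix (splitEquiv c) (splitEquiv c)) =
      Matrix.diagonal fun y => Complex.exp (Complex.I *
        ((θ (y ∘ (ι ∘ Fin.succ)) * zSign (y (ι 0)) : ℝ) : ℂ)) := by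
  rw [blockPhase, Matrix.fromBlocks_diagonal, Matrix.submatrix_diagonal_equiv, embedOp_diagonal]
  congr 1
  funext y
  by_cases hy : y (ι 0) = 0
  · simp [splitEquiv, hy, tail_comp, zSign]
  · simp [splitEquiv, hy, tail_comp, zSign]

/-- Conjugation by this matrix turns the Pauli matrix `Z` into `Y`. -/
def basisY : Matrix (Fin 2) (Fin 2) ℂ :=
  ((√2 : ℝ) : ℂ)⁻¹ • !![1, 1; Complex.I, -Complex.I]

theorem star_basisY : star basisY = ((√2 : ℝ) : ℂ)⁻¹ • !![1, -Complex.I; 1, Complex.I] := by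
  ext i j
  fin_cases i <;> fin_cases j <;> simp [basisY, Matrix.star_apply]

theorem basisY_mul_diagonal_mul (f : Fin 2 → ℂ) :
    basisY * Matrix.diagonal f * star basisY =
      !![(f 0 + f 1) / 2, -Complex.I * (f 0 - f 1) / 2;
        Complex.I * (f 0 - f 1) / 2, (f 0 + f 1) / 2] := by
  have h : Matrix.diagonal f = !![f 0, 0; 0, f 1] := by
    ext i j; fin_cases i <;> fin_cases j <;> simp
  rw [star_basisY]
  simp only [basisY, Matrix.smul_mul, Matrix.mul_smul, smul_smul, sqrt_two_inv_mul_self]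
  rw [h, Matrix.mul_fin_two, Matrix.mul_fin_two]
  ext i j
  fin_cases i <;> fin_cases j <;> simp <;> ring_nf
  simp only [Complex.I_sq]
  ring

theorem basisY_mem_unitaryGroup : basisY ∈ Matrix.unitaryGroup (Fin 2) ℂ := by
  have h := basisY_mul_diagonal_mul 1
  have h1 : Matrix.diagonal (1 : Fin 2 → ℂ) = 1 := Matrix.diagonal_one
  rw [h1, mul_one] at h
  rw [Matrix.mem_unitaryGroup_iff, h]
  ext i j
  fin_cases i <;> fin_cases j <;> simp

/-- A block rotation is a multiplexed rotation about the `Y` axis, and `basisY` carries `Z` to `Y`.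
The angle changes sign because `e^{-iθY}` is the rotation by `+θ`. -/
theorem embedOp_blockRotation (hι : Function.Injective ι) (θ : (Fin c → Fin 2) → ℝ) :
    embedOp ι ((blockRotation θ).submatrix (splitEquiv c) (splitEquiv c)) =
      muxOp (ι 0) (fun _ => basisY) *
      (Matrix.diagonal fun y => Complex.exp (Complex.I *
        ((-θ (y ∘ (ι ∘ Fin.succ)) * zSign (y (ι 0)) : ℝ) : ℂ))) *
      muxOp (ι 0) fun _ => star basisY := by
  have htail (y : Q → Fin 2) (b : Fin 2) :
      Function.update y (ι 0) b ∘ (ι ∘ Fin.succ) = y ∘ (ι ∘ Fin.succ) := by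
    funext i
    exact Function.update_of_ne (fun h => Fin.succ_ne_zero i (hι h)) _ _
  rw [diagonal_eq_muxOp (ι 0), muxOp_mul _ _ _ (by simp), muxOp_mul _ _ _ (by
    intro y b; simp only [Function.update_idem])]
  ext x y
  simp only [htail, Function.update_self, basisY_mul_diagonal_mul, muxOp, embedOp, Matrix.of_apply,
    Matrix.submatrix_apply]
  have hiff : x = Function.update y (ι 0) (x (ι 0)) ↔
      (∀ r, r ∉ Set.range ι → x r = y r) ∧ x ∘ (ι ∘ Fin.succ) = y ∘ (ι ∘ Fin.succ) := by
    constructor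
    · intro h
      rw [h, htail]
      refine ⟨fun r hr => Function.update_of_ne ?_ _ _, rfl⟩
      rintro rfl
      exact hr ⟨_, rfl⟩
    · rintro ⟨h1, h2⟩
      funext r
      by_cases h : r ∈ Set.range ι
      · obtain ⟨i, rfl⟩ := h
        induction i using Fin.cases with
        | zero => simp
        | succ i =>
          rw [Function.update_of_ne fun h => Fin.succ_ne_zero i (hι h)]
          exact congrFun h2 i
      · rw [Function.update_of_ne (fun h2 => h ⟨_, h2.symm⟩)]
        exact h1 r h
  simp only [hiff, ite_and]
  by_cases h : ∀ r, r ∉ Set.range ι → x r = y r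
  · rw [if_pos h, if_pos h]
    have hs (v : ℝ) : Complex.exp (Complex.I * ((v : ℝ) : ℂ)) =
        Complex.cos v + Complex.sin v * Complex.I := by
      rw [mul_comm, Complex.exp_mul_I]
    by_cases ht : x ∘ (ι ∘ Fin.succ) = y ∘ (ι ∘ Fin.succ)
    · rw [if_pos ht]
      have e1 (z : ℂ) : (z.cos - z.sin * Complex.I + (z.cos + z.sin * Complex.I)) / 2 = z.cos := by
        ring
      have e2 (z : ℂ) : Complex.I * (z.cos - z.sin * Complex.I - (z.cos + z.sin * Complex.I)) / 2 =
          z.sin := by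
        linear_combination (-z.sin) * Complex.I_mul_I
      by_cases hx : x (ι 0) = 0 <;> by_cases hy : y (ι 0) = 0
      all_goals
        first | replace hx : x (ι 0) = 0 := hx | replace hx : x (ι 0) = 1 := by omega
        first | replace hy : y (ι 0) = 0 := hy | replace hy : y (ι 0) = 1 := by omega
        simp only [splitEquiv, blockRotation, Equiv.coe_fn_mk, Function.comp_apply, hx, hy,
          tail_comp, ht, if_true, one_ne_zero, if_false, Matrix.fromBlocks_apply₁₁,
          Matrix.fromBlocks_apply₁₂, Matrix.fromBlocks_apply₂₁, Matrix.fromBlocks_apply₂₂,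
          Matrix.diagonal_apply_eq, Matrix.neg_apply, hs, zSign,
          Matrix.cons_val_zero, Matrix.cons_val_one]
        push_cast
        simp only [mul_one, mul_neg, neg_neg, Complex.cos_neg, Complex.sin_neg, neg_mul,
          ← sub_eq_add_neg, e1, e2, neg_div]
    · rw [if_neg ht]
      by_cases hx : x (ι 0) = 0 <;> by_cases hy : y (ι 0) = 0 <;>
        simp [splitEquiv, blockRotation, hx, hy, tail_comp, ht]
  · rw [if_neg h, if_neg h]

/-- A bound for the number of CNOT gates in a circuit for an arbitrary unitary on `c` qubits. -/
def unitaryCost : ℕ → ℕ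
  | 0 => 0
  | c + 1 => 4 * unitaryCost c + 3 * (2 ^ (c + 1) - 2)

theorem HasCost.embedMux {c : ℕ} {ι : Fin (c + 1) → Q} (hι : Function.Injective ι)
    (θ : (Fin c → Fin 2) → ℝ) :
    HasCost (Matrix.diagonal fun y => Complex.exp (Complex.I *
        ((θ (y ∘ (ι ∘ Fin.succ)) * zSign (y (ι 0)) : ℝ) : ℂ))) (2 ^ (c + 1) - 2) := by
  have h := HasCost.muxZ (ι 0) (Finset.univ.image (ι ∘ Fin.succ)) (by
      simp only [Finset.mem_image, Finset.mem_univ, true_and, not_exists]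
      exact fun i hi => Fin.succ_ne_zero i (hι hi))
    (fun y => θ (y ∘ (ι ∘ Fin.succ))) (by
      intro x y hxy
      dsimp only
      congr 1
      funext i
      exact hxy _ (by simp))
  rwa [Finset.card_image_of_injective _ (hι.comp (Fin.succ_injective c)), Finset.card_univ,
    Fintype.card_fin] at h

/-- Every unitary on `c` of the qubits has a circuit with at most `unitaryCost c` CNOT gates. -/
theorem HasCost.embedOp [Nonempty Q] {c : ℕ} {ι : Fin c → Q} (hι : Function.Injective ι)
    {U : Matrix (Fin c → Fin 2) (Fin c → Fin 2) ℂ} (hU : U ∈ Matrix.unitaryGroup _ ℂ) :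
    HasCost (embedOp ι U) (unitaryCost c) := by
  induction c with
  | zero =>
    -- A unitary on no qubits is a global phase. It is realized as a one-qubit gate on any available
    -- qubit, hence the assumption that `Q` is nonempty.
    obtain ⟨V, hV, θ, h⟩ := exists_unitary_conj_diagonal hU
    have hVV : V * star V = 1 := Matrix.mem_unitaryGroup_iff.1 hV
    have hUd : U = Matrix.diagonal fun i => Complex.exp (Complex.I * θ i) := by
      ext i j
      rw [h, mul_assoc]
      have hij : j = i := Subsingleton.elim _ _
      subst hij
      have h2 := congrFun (congrFun hVV j) j
      rw [Matrix.mul_apply, Fintype.sum_subsingleton _ j] at h2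
      rw [Matrix.mul_apply, Fintype.sum_subsingleton _ j, Matrix.diagonal_mul,
        Matrix.diagonal_apply_eq, mul_left_comm, h2]
      simp
    rw [hUd, embedOp_diagonal]
    have h := HasCost.diagonal (Q := Q) ∅ (fun y => θ (y ∘ ι)) fun x y _ => by
      dsimp only; congr 1; exact Subsingleton.elim _ _
    simpa [unitaryCost] using h
  | succ c ih =>
    -- Cosine-sine decomposition followed by demultiplexing of both outer factors: four unitaries on
    -- one qubit fewer and three multiplexed rotations, which is the recursion of `unitaryCost`.
    have hι' : Function.Injective (ι ∘ Fin.succ) := hι.comp (Fin.succ_injective c)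
    have hM := submatrix_mem_unitaryGroup (splitEquiv c).symm hU
    have hUM : U = (U.submatrix (splitEquiv c).symm (splitEquiv c).symm).submatrix
        (splitEquiv c) (splitEquiv c) := by simp
    generalize U.submatrix (splitEquiv c).symm (splitEquiv c).symm = M at hM hUM
    subst hUM
    obtain ⟨A₁, hA₁, A₂, hA₂, B₁, hB₁, B₂, hB₂, θ, rfl⟩ := exists_cosineSine hM
    obtain ⟨V, hV, W, hW, φ, hA⟩ := exists_demultiplex hA₁ hA₂
    obtain ⟨V', hV', W', hW', φ', hB⟩ := exists_demultiplex hB₁ hB₂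
    have hdemux : ∀ {V W : Matrix (Fin c → Fin 2) (Fin c → Fin 2) ℂ} {φ : (Fin c → Fin 2) → ℝ}, V ∈ Matrix.unitaryGroup _ ℂ → W ∈ Matrix.unitaryGroup _ ℂ →
        HasCost (ElasticWave.embedOp ι ((Matrix.fromBlocks V 0 0 V * blockPhase φ *
          Matrix.fromBlocks W 0 0 W).submatrix (splitEquiv c) (splitEquiv c)))
          (2 * unitaryCost c + (2 ^ (c + 1) - 2)) := by
      intro V W φ hV hW
      refine (((ih hι' hV).mul (HasCost.embedMux hι φ)).mul (ih hι' hW)).of_eq ?_ (by omega)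
      rw [← Matrix.submatrix_mul_equiv _ _ _ (splitEquiv c), embedOp_mul hι,
        ← Matrix.submatrix_mul_equiv _ _ _ (splitEquiv c), embedOp_mul hι,
        embedOp_fromBlocks_same hι, embedOp_fromBlocks_same hι, embedOp_blockPhase]
    have hrot : HasCost (ElasticWave.embedOp ι ((blockRotation θ).submatrix (splitEquiv c)
        (splitEquiv c))) (2 ^ (c + 1) - 2) := by
      refine (((HasCost.single (ι 0) basisY_mem_unitaryGroup).mul
        (HasCost.embedMux hι fun w => -θ w)).mul
        (HasCost.single (ι 0) (Unitary.star_mem basisY_mem_unitaryGroup))).of_eq ?_ (by omega)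
      rw [embedOp_blockRotation hι]
    rw [hA, hB]
    refine (((hdemux hV hW (φ := φ)).mul hrot).mul (hdemux hV' hW' (φ := φ'))).of_eq ?_ ?_
    · rw [← Matrix.submatrix_mul_equiv _ _ _ (splitEquiv c), embedOp_mul hι,
        ← Matrix.submatrix_mul_equiv _ _ _ (splitEquiv c), embedOp_mul hι]
    · rw [unitaryCost]; omega

end

/-! ### Operators on the two registers -/

section registers

open scoped Kronecker

variable {n : ℕ}

/-- `stateIndex` as an equivalence. -/
def stateEquiv : (Fin 4 → Fin 2) ≃ Fin 16 := finFunctionFinEquiv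

/-- The basis states of the two registers. -/
def registerEquiv (n : ℕ) : (Qubit n → Fin 2) ≃ Fin 16 × (SpaceQubit n → Fin 2) :=
  (Equiv.sumArrowEquivProdArrow _ _ _).trans (Equiv.prodCongr stateEquiv (Equiv.refl _))

theorem onRegisters_eq (X : Matrix (Fin 16) (Fin 16) ℂ)
    (Y : Matrix (SpaceQubit n → Fin 2) (SpaceQubit n → Fin 2) ℂ) :
    onRegisters X Y = (X ⊗ₖ Y).submatrix (registerEquiv n) (registerEquiv n) := rfl

variable (X X' : Matrix (Fin 16) (Fin 16) ℂ)
  (Y Y' : Matrix (SpaceQubit n → Fin 2) (SpaceQubit n → Fin 2) ℂ)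

theorem onRegisters_mul : onRegisters (X * X') (Y * Y') = onRegisters X Y * onRegisters X' Y' := by
  simp only [onRegisters_eq, Matrix.mul_kronecker_mul, Matrix.submatrix_mul_equiv]

theorem onRegisters_one : onRegisters (n := n) 1 1 = 1 := by
  simp only [onRegisters_eq, Matrix.one_kronecker_one, Matrix.submatrix_one_equiv]

theorem onRegisters_zero_left : onRegisters 0 Y = 0 := by
  ext; simp [onRegisters]

theorem onRegisters_smul_left (c : ℂ) : onRegisters (c • X) Y = c • onRegisters X Y := by
  ext; simp [onRegisters, mul_assoc]

theorem onRegisters_smul_right (c : ℂ) : onRegisters X (c • Y) = c • onRegisters X Y := by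
  ext; simp [onRegisters, mul_left_comm]

theorem onRegisters_sum_left {κ : Type*} (s : Finset κ) (F : κ → Matrix (Fin 16) (Fin 16) ℂ) :
    onRegisters (∑ i ∈ s, F i) Y = ∑ i ∈ s, onRegisters (F i) Y := by
  ext; simp [onRegisters, Matrix.sum_apply, Finset.sum_mul]

theorem onRegisters_sum_right {κ : Type*} (s : Finset κ)
    (F : κ → Matrix (SpaceQubit n → Fin 2) (SpaceQubit n → Fin 2) ℂ) :
    onRegisters X (∑ i ∈ s, F i) = ∑ i ∈ s, onRegisters X (F i) := by
  ext; simp [onRegisters, Matrix.sum_apply, Finset.mul_sum]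

theorem star_onRegisters : star (onRegisters X Y) = onRegisters (star X) (star Y) := by
  simp only [onRegisters_eq, Matrix.star_eq_conjTranspose, Matrix.conjTranspose_submatrix,
    Matrix.conjTranspose_kronecker]

theorem onRegisters_one_right :
    onRegisters (n := n) X 1 = embedOp Sum.inl (X.submatrix stateEquiv stateEquiv) := by
  ext x y
  simp only [onRegisters, embedOp, Matrix.of_apply, Matrix.submatrix_apply, Matrix.one_apply,
    mul_ite, mul_one, mul_zero]
  have h : (∀ r, r ∉ Set.range Sum.inl → x r = y r) ↔
      (fun q => x (Sum.inr q)) = fun q => y (Sum.inr q) := by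
    simp [funext_iff]
  by_cases hxy : (fun q => x (Sum.inr q)) = fun q => y (Sum.inr q)
  · rw [if_pos hxy, if_pos (h.2 hxy)]; rfl
  · rw [if_neg hxy, if_neg fun h' => hxy (h.1 h')]

theorem HasCost.onRegisters {U : Matrix (Fin 16) (Fin 16) ℂ}
    (hU : U ∈ Matrix.unitaryGroup (Fin 16) ℂ) : HasCost (onRegisters (n := n) U 1) 210 := by
  have : Nonempty (Qubit n) := ⟨Sum.inl 0⟩
  have h := HasCost.embedOp (Q := Qubit n) (ι := Sum.inl) Sum.inl_injective
    (submatrix_mem_unitaryGroup stateEquiv hU)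
  -- The values of `unitaryCost` from 0 to 4 are 0, 0, 6, 42, 210.
  exact h.of_eq (onRegisters_one_right U) (by norm_num [unitaryCost])

end registers

/-! ### Regrouping products of exponentials -/

section lists

variable {M : Type*} [Monoid M] {ι κ : Type*}

theorem prod_map_mul_prod_map_of_commute (l : List κ) (f g : κ → M)
    (h : ∀ k k', Commute (f k) (g k')) :
    (l.map f).prod * (l.map g).prod = (l.map fun k => f k * g k).prod := by
  induction l with
  | nil => simp
  | cons k l ih =>
    have hc : Commute (l.map f).prod (g k) :=
      Commute.list_prod_left _ _ fun x hx => by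
        obtain ⟨k', -, rfl⟩ := List.mem_map.1 hx
        exact h _ _
    simp only [List.map_cons, List.prod_cons, ← ih]
    rw [mul_assoc, ← mul_assoc _ (g k), hc.eq]
    simp only [mul_assoc]

/-- Interchange of two nested products. Commutation is required only for different `j`, so for each
`j` the order in `k` is preserved and no relation between different `k` is needed. -/
theorem prod_flatMap_map_comm {l : List ι} (hl : l.Nodup) (l' : List κ) (F : ι → κ → M)
    (h : ∀ j j' k k', j ≠ j' → Commute (F j k) (F j' k')) :
    (l.flatMap fun j => l'.map (F j)).prod =
      (l'.map fun k => (l.map fun j => F j k).prod).prod := by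
  induction l with
  | nil => simp
  | cons j l ih =>
    obtain ⟨hj, hl⟩ := List.nodup_cons.1 hl
    simp only [List.flatMap_cons, List.prod_append, List.map_cons, List.prod_cons, ih hl]
    refine prod_map_mul_prod_map_of_commute l' _ _ fun k k' => ?_
    refine Commute.list_prod_right _ _ fun x hx => ?_
    obtain ⟨j', hj', rfl⟩ := List.mem_map.1 hx
    exact h _ _ _ _ (by rintro rfl; exact hj hj')

theorem reverse_prod_flatMap_map_comm {l : List ι} (hl : l.Nodup) (l' : List κ) (F : ι → κ → M)
    (h : ∀ j j' k k', j ≠ j' → Commute (F j k) (F j' k')) :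
    (l.flatMap fun j => l'.map (F j)).reverse.prod =
      (l'.reverse.map fun k => (l.reverse.map fun j => F j k).prod).prod := by
  rw [← prod_flatMap_map_comm (List.nodup_reverse.2 hl) l'.reverse F h, List.reverse_flatMap]
  simp only [Function.comp_def, List.map_reverse]

theorem prod_map_conj (l : List κ) (F : κ → M) {V W : M} (hVW : V * W = 1) (hWV : W * V = 1) :
    (l.map fun k => V * F k * W).prod = V * (l.map F).prod * W := by
  induction l with
  | nil => simp [hVW]
  | cons k l ih =>
    simp only [List.map_cons, List.prod_cons, ih]
    calc V * F k * W * (V * (l.map F).prod * W) = V * F k * (W * V) * (l.map F).prod * W := by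
          simp only [mul_assoc]
      _ = _ := by rw [hWV, mul_one]; simp only [mul_assoc]

end lists

theorem prod_map_exp_of_commute {ι κ : Type*} [Fintype ι] [DecidableEq ι] {l : List κ}
    (hl : l.Nodup) (T : κ → Matrix ι ι ℂ) (h : ∀ j j', j ≠ j' → Commute (T j) (T j')) :
    (l.map fun j => NormedSpace.exp (T j)).prod = NormedSpace.exp (l.map T).sum := by
  induction l with
  | nil => simp
  | cons j l ih =>
    obtain ⟨hj, hl⟩ := List.nodup_cons.1 hl
    simp only [List.map_cons, List.prod_cons, List.sum_cons, ih hl]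
    refine (Matrix.exp_add_of_commute _ _ ?_).symm
    refine Commute.list_sum_right _ _ fun x hx => ?_
    obtain ⟨j', hj', rfl⟩ := List.mem_map.1 hx
    exact h _ _ (by rintro rfl; exact hj hj')

/-! ### Spectral projectors and the merging of the factors over `j`. -/

section

variable {ρ : ℝ} {S : Matrix (Fin 6) (Fin 6) ℝ} (E : Eigendecomposition ρ S) {n : ℕ}

theorem Eigendecomposition.proj_eq (α : Fin 3) (j : Fin 16) :
    E.proj α j = basisMatrix (E.vec α) * Matrix.diagonal (Pi.single j 1) *
      star (basisMatrix (E.vec α)) := by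
  ext a b
  rw [Matrix.mul_apply, Finset.sum_eq_single j]
  · simp [Eigendecomposition.proj, Matrix.vecMulVec_apply, basisMatrix, Matrix.star_apply]
  · intro i _ hi
    simp [hi]
  · simp

theorem Eigendecomposition.stateMat_eq (α : Fin 3) :
    stateMat ρ S α = basisMatrix (E.vec α) * Matrix.diagonal (fun j => (E.val α j : ℂ)) *
      star (basisMatrix (E.vec α)) := by
  have h : stateMat ρ S α * basisMatrix (E.vec α) =
      basisMatrix (E.vec α) * Matrix.diagonal (fun j => (E.val α j : ℂ)) := by
    ext a j
    have h1 := congrFun (E.eigen α j) a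
    rw [Matrix.mul_diagonal, mul_comm]
    exact h1
  rw [← h, mul_assoc, Matrix.mem_unitaryGroup_iff.1 (basisMatrix_mem_unitaryGroup _), mul_one]

theorem Eigendecomposition.sum_proj (α : Fin 3) :
    ∑ j, (E.val α j : ℂ) • E.proj α j = stateMat ρ S α := by
  have h : Matrix.diagonal (fun j => (E.val α j : ℂ)) =
      ∑ j, (E.val α j : ℂ) • Matrix.diagonal (Pi.single j (1 : ℂ)) := by
    ext a b
    rw [Matrix.sum_apply]
    by_cases hab : a = b
    · subst hab; simp [Pi.single_apply]
    · simp [hab]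
  rw [E.stateMat_eq, h, Finset.mul_sum, Finset.sum_mul]
  refine Finset.sum_congr rfl fun j _ => ?_
  rw [E.proj_eq, Matrix.mul_smul, Matrix.smul_mul]

theorem Eigendecomposition.proj_mul_proj (α : Fin 3) {j j' : Fin 16} (h : j ≠ j') :
    E.proj α j * E.proj α j' = 0 := by
  have hV := Matrix.mem_unitaryGroup_iff'.1 (basisMatrix_mem_unitaryGroup (E.vec α))
  have hd : Matrix.diagonal (Pi.single j (1 : ℂ)) * Matrix.diagonal (Pi.single j' (1 : ℂ)) = 0 := by
    rw [Matrix.diagonal_mul_diagonal, ← Matrix.diagonal_zero]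
    congr 1
    funext i
    by_cases hi : i = j
    · subst hi; simp [h]
    · simp [hi]
  rw [E.proj_eq, E.proj_eq]
  set V := basisMatrix (E.vec α)
  calc V * Matrix.diagonal (Pi.single j 1) * star V *
        (V * Matrix.diagonal (Pi.single j' 1) * star V) =
      V * Matrix.diagonal (Pi.single j 1) * (star V * V) *
        Matrix.diagonal (Pi.single j' 1) * star V := by simp only [mul_assoc]
    _ = V * (Matrix.diagonal (Pi.single j 1) * Matrix.diagonal (Pi.single j' 1)) * star V := by
        rw [hV, mul_one]; simp only [mul_assoc]
    _ = 0 := by rw [hd]; simp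

/-- The sum `B_cell^{-1/2} A^{(α)} B_cell^{-1/2} ⊗ (i / 2h) S_k^{(α)}` of the terms with the
given `α` and `k`. -/
def axisTerm (n : ℕ) (h ρ : ℝ) (S : Matrix (Fin 6) (Fin 6) ℝ) (α : Fin 3) (k : Fin n) :
    Matrix (Qubit n → Fin 2) (Qubit n → Fin 2) ℂ :=
  onRegisters (stateMat ρ S α) ((Complex.I / (2 * (h : ℂ))) • shiftTerm α k)

theorem Eigendecomposition.term_eq (h : ℝ) (α : Fin 3) (j : Fin 16) (k : Fin n) :
    E.term h α j k = onRegisters ((E.val α j : ℂ) • E.proj α j)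
      ((Complex.I / (2 * (h : ℂ))) • shiftTerm α k) := by
  rw [Eigendecomposition.term, onRegisters_smul_right, onRegisters_smul_left,
    onRegisters_smul_right, smul_smul]
  congr 1
  ring

theorem Eigendecomposition.sum_term (h : ℝ) (α : Fin 3) (k : Fin n) :
    ∑ j, E.term h α j k = axisTerm n h ρ S α k := by
  simp only [E.term_eq]
  rw [← onRegisters_sum_left, E.sum_proj, axisTerm]

/-- Orthogonality of the projectors makes both products zero, even when `k` and `k'` differ and the
shift terms themselves need not commute. -/
theorem Eigendecomposition.term_commute (h : ℝ) (α : Fin 3) {j j' : Fin 16} (hj : j ≠ j')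
    (k k' : Fin n) : Commute (E.term h α j k) (E.term h α j' k') := by
  have hz : ∀ {i i' : Fin 16} (l l' : Fin n), i ≠ i' → E.term h α i l * E.term h α i' l' = 0 := by
    intro i i' l l' hi
    rw [Eigendecomposition.term, Eigendecomposition.term, ← onRegisters_mul, E.proj_mul_proj α hi,
      onRegisters_zero_left]
  rw [Commute, SemiconjBy, hz k k' hj, hz k' k hj.symm]

theorem Eigendecomposition.evolution_term_commute (h t : ℝ) (α : Fin 3) {j j' : Fin 16}
    (hj : j ≠ j') (k k' : Fin n) :
    Commute (evolution (E.term h α j k) t) (evolution (E.term h α j' k') t) := by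
  have hc : Commute ((-(Complex.I * (t : ℂ))) • E.term h α j k)
    ((-(Complex.I * (t : ℂ))) • E.term h α j' k') :=
    ((E.term_commute h α hj k k').smul_left _).smul_right _
  rw [Commute, SemiconjBy, evolution, evolution, ← Matrix.exp_add_of_commute _ _ hc,
    ← Matrix.exp_add_of_commute _ _ hc.symm, add_comm]

theorem Eigendecomposition.prod_evolution_term (h t : ℝ) (α : Fin 3) (k : Fin n)
    {l : List (Fin 16)} (hl : l.Nodup) (hl' : ∀ j, j ∈ l) :
    (l.map fun j => evolution (E.term h α j k) t).prod = evolution (axisTerm n h ρ S α k) t := by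
  simp only [evolution]
  rw [prod_map_exp_of_commute hl _ fun j j' hj =>
    ((E.term_commute h α hj k k).smul_left _).smul_right _, ← E.sum_term, Finset.smul_sum]
  congr 1
  rw [← List.sum_toFinset _ hl]
  congr 1
  ext j
  simp [hl']

/-- The product over `k` of the exponentials of the terms for the axis `α`. -/
def axisFactors (n : ℕ) (h ρ : ℝ) (S : Matrix (Fin 6) (Fin 6) ℝ) (t : ℝ) (α : Fin 3) :
    List (Matrix (Qubit n → Fin 2) (Qubit n → Fin 2) ℂ) :=
  (List.finRange n).map fun k => evolution (axisTerm n h ρ S α k) t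

theorem list_prod_flatMap {M κ : Type*} [Monoid M] (l : List κ) (f : κ → List M) :
    (l.flatMap f).prod = (l.map fun x => (f x).prod).prod := by
  induction l with
  | nil => simp
  | cons x l ih => simp [ih]

/-- The product over `j` is moved inside the one over `k` and collapses to the exponential of the
sum over `j`, which no longer depends on the eigenbasis. -/
theorem Eigendecomposition.factors_prod (h t : ℝ) :
    (E.factors n h t).prod = ((List.finRange 3).flatMap (axisFactors n h ρ S t)).prod := by
  rw [Eigendecomposition.factors, list_prod_flatMap, list_prod_flatMap]
  congr 2
  funext α
  rw [prod_flatMap_map_comm (List.nodup_finRange 16) _ _ fun j j' k k' hj =>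
    E.evolution_term_commute h t α hj k k', axisFactors]
  congr 2
  funext k
  exact E.prod_evolution_term h t α k (List.nodup_finRange 16) List.mem_finRange

theorem Eigendecomposition.factors_reverse_prod (h t : ℝ) :
    (E.factors n h t).reverse.prod =
      ((List.finRange 3).flatMap (axisFactors n h ρ S t)).reverse.prod := by
  rw [Eigendecomposition.factors, List.reverse_flatMap, List.reverse_flatMap, list_prod_flatMap,
    list_prod_flatMap]
  congr 2
  funext α
  simp only [Function.comp_apply]
  rw [reverse_prod_flatMap_map_comm (List.nodup_finRange 16) _ _ fun j j' k k' hj =>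
    E.evolution_term_commute h t α hj k k', axisFactors, ← List.map_reverse]
  congr 2
  funext k
  exact E.prod_evolution_term h t α k (List.nodup_reverse.2 (List.nodup_finRange 16))
    fun j => List.mem_reverse.2 (List.mem_finRange j)

theorem Eigendecomposition.trotter2_eq (h τ : ℝ) :
    E.trotter2 n h τ = ((List.finRange 3).flatMap (axisFactors n h ρ S (τ / 2))).reverse.prod *
      ((List.finRange 3).flatMap (axisFactors n h ρ S (τ / 2))).prod := by
  rw [Eigendecomposition.trotter2, E.factors_prod, E.factors_reverse_prod]

end

/-! ### Fan-out -/

section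

variable {Q : Type*} [Fintype Q] [DecidableEq Q]

/-- Add the bit `t` to all the bits in `s`. -/
def fanOut (t : Q) (s : Finset Q) (y : Q → Fin 2) (r : Q) : Fin 2 :=
  if r ∈ s then y r + y t else y r

theorem fanOut_involutive {t : Q} {s : Finset Q} (ht : t ∉ s) :
    Function.Involutive (fanOut t s) := by
  intro y
  funext r
  by_cases hr : r ∈ s
  · simp [fanOut, hr, ht, fin_two_add_add]
  · simp [fanOut, hr]

theorem HasCost.fanOut {t : Q} (s : Finset Q) (ht : t ∉ s) :
    HasCost (permOp (fanOut t s)) s.card := by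
  induction s using Finset.induction_on with
  | empty =>
    refine HasCost.one.of_eq ?_ le_rfl
    ext x y
    simp [permOp, ElasticWave.fanOut, Matrix.one_apply, funext_iff]
  | insert c s hc ih =>
    have htc : t ≠ c := fun h => ht (by simp [h])
    have hts : t ∉ s := fun h => ht (by simp [h])
    refine ((HasCost.cnot htc).mul (ih hts)).of_eq ?_
      (by rw [Finset.card_insert_of_notMem hc]; omega)
    rw [permOp_mul]
    congr 1
    funext y r
    simp only [Function.comp_apply]
    by_cases hr : r = c
    · subst hr
      rw [ctrlNot_self]
      have hpb : propBit (ElasticWave.fanOut t s y t = 1) = y t := by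
        simp only [ElasticWave.fanOut, hts, if_false]
        by_cases h1 : y t = 1
        · rw [propBit_of h1, h1]
        · rw [propBit_of_not h1]; omega
      rw [hpb]
      simp [ElasticWave.fanOut, hc]
    · rw [ctrlNot_of_ne _ hr]
      simp [ElasticWave.fanOut, hr]

theorem star_permOp {f : (Q → Fin 2) → Q → Fin 2} (hf : Function.Involutive f) :
    star (permOp f) = permOp f := by
  ext x y
  simp only [permOp, Matrix.star_apply, Matrix.of_apply]
  have : y = f x ↔ x = f y := ⟨fun h => by rw [h, hf], fun h => by rw [h, hf]⟩
  simp only [this]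
  split_ifs <;> simp

theorem star_muxOp_const (t : Q) (u : Matrix (Fin 2) (Fin 2) ℂ) :
    star (muxOp t fun _ => u) = muxOp t fun _ => star u := by
  ext x y
  simp only [muxOp, Matrix.star_apply, Matrix.of_apply]
  have : y = Function.update x t (y t) ↔ x = Function.update y t (x t) := by
    constructor <;> intro h <;> rw [h] <;> simp
  simp only [this]
  split_ifs <;> simp

theorem permOp_mul_self {f : (Q → Fin 2) → Q → Fin 2} (hf : Function.Involutive f) :
    permOp f * permOp f = 1 := by
  rw [permOp_mul, hf.comp_self]
  ext x y
  simp [permOp, Matrix.one_apply]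

theorem muxOp_const_mul_star (t : Q) {u : Matrix (Fin 2) (Fin 2) ℂ}
    (hu : u ∈ Matrix.unitaryGroup (Fin 2) ℂ) :
    (muxOp t fun _ => u) * (muxOp t fun _ => star u) = 1 := by
  have h : (1 : Matrix (Q → Fin 2) (Q → Fin 2) ℂ) = muxOp t fun _ => 1 := by
    rw [← Matrix.diagonal_one, diagonal_eq_muxOp t]
    congr 1
  rw [muxOp_mul _ _ _ (by simp), Matrix.mem_unitaryGroup_iff.1 hu, h]

end

/-! ### The shift terms -/

section

variable {n : ℕ} (α : Fin 3) (k : Fin n)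

/-- The qubit of weight `2 ^ k` on the axis `α`. -/
def spaceQubit : Qubit n := Sum.inr (α, k)

/-- The qubits of lower weight on the axis `α`. -/
def lowerQubits : Finset (Qubit n) :=
  (Finset.univ.filter (· < k)).image fun i => Sum.inr (α, i)

/-- All the qubits of lower weight on the axis `α` are set. -/
def LowerSet (y : Qubit n → Fin 2) : Prop := ∀ i < k, y (Sum.inr (α, i)) = 1

theorem mem_lowerQubits {r : Qubit n} : r ∈ lowerQubits α k ↔ ∃ i < k, r = Sum.inr (α, i) := by
  simp [lowerQubits, eq_comm]

theorem spaceQubit_notMem_lowerQubits : spaceQubit α k ∉ lowerQubits α k := by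
  rw [mem_lowerQubits]
  rintro ⟨i, hi, h⟩
  simp only [spaceQubit, Sum.inr.injEq, Prod.mk.injEq, true_and] at h
  exact hi.ne h.symm

theorem card_lowerQubits_le : (lowerQubits α k).card ≤ k := by
  refine Finset.card_image_le.trans (le_of_eq ?_)
  have : (Finset.univ.filter (· < k)) = Finset.Iio k := by ext; simp
  rw [this, Fin.card_Iio]

theorem ignores_lowerSet : Ignores (LowerSet α k) (spaceQubit α k) := by
  intro y b
  simp only [LowerSet, eq_iff_iff]
  refine forall₂_congr fun i hi => ?_
  rw [Function.update_of_ne]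
  simp [spaceQubit, hi.ne]

theorem HasCost.lowerSet : HasCost (permOp (ctrlNot (LowerSet α k) (spaceQubit α k)))
    (32 * (k : ℕ)) := by
  obtain ⟨k, hk⟩ := k
  cases k with
  | zero =>
    -- With no lower bits the condition is vacuous and the flip is a one-qubit gate.
    refine (HasCost.not (spaceQubit α ⟨0, hk⟩)).of_eq ?_ le_rfl
    congr 2
    funext y
    simp only [LowerSet, eq_iff_iff, iff_true]
    intro i hi
    exact absurd hi (by simp [Fin.lt_def])
  | succ j =>
    have hα : α + 1 ≠ α := by revert α; decide
    -- The controls are the `j + 1` lower bits on the axis `α`. The `j` borrowed qubits are the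
    -- lowest ones on the axis `α + 1`, and the target comes last as `q j`. Values at other indices
    -- are irrelevant.
    let x : ℕ → Qubit n := fun i =>
      if h : i < n then Sum.inr (α, ⟨i, h⟩) else Sum.inr (α, ⟨j + 1, hk⟩)
    let q : ℕ → Qubit n := fun i =>
      if i < j then (if h : i < n then Sum.inr (α + 1, ⟨i, h⟩) else Sum.inl 0)
      else Sum.inr (α, ⟨j + 1, hk⟩)
    have hx : ∀ i (h : i < n), x i = Sum.inr (α, ⟨i, h⟩) := fun i h => by simp [x, h]
    have hq1 : ∀ i (h : i < j), q i = Sum.inr (α + 1, ⟨i, by omega⟩) := fun i h => by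
      have : i < n := by omega
      simp [q, h, this]
    have hq2 : q j = Sum.inr (α, ⟨j + 1, hk⟩) := by simp [q]
    have h := HasCost.multiControlled (x := x) (q := q) (N := j) (j := j) ?_ ?_ le_rfl
    · refine h.of_eq ?_ le_rfl
      congr 1
      have hA : LowerSet α ⟨j + 1, hk⟩ = AllSet x j := by
        funext y
        simp only [LowerSet, AllSet, eq_iff_iff]
        constructor
        · intro h i hi
          rw [hx i (by omega)]
          exact h _ (by simp [Fin.lt_def]; omega)
        · intro h i hi
          rw [Fin.lt_def] at hi
          have := h i (by simp at hi; omega)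
          rwa [hx i i.2] at this
      rw [hA, hq2, spaceQubit]
    · intro i hi l hl
      rw [hx i (by omega)]
      rcases Nat.lt_or_ge l j with h | h
      · rw [hq1 l h]; simp [hα.symm]
      · rw [le_antisymm hl h, hq2]; simp; omega
    · intro i hi l hl hil
      rcases Nat.lt_or_ge l j with h | h
      · rcases Nat.lt_or_ge i j with h' | h'
        · rw [hq1 l h, hq1 i h']; simp [hil]
        · rw [le_antisymm hi h', hq2, hq1 l h]; simp [hα.symm]
      · have hl' := le_antisymm hl h
        have h' : i < j := by omega
        rw [hl', hq2, hq1 i h']; simp [hα]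

/-- The matrix unit with the entry `1` in the position `(c, d)`. -/
def bitUnit (c d : Fin 2) : Matrix (Fin 2) (Fin 2) ℂ :=
  Matrix.of fun i j => if i = c ∧ j = d then 1 else 0

theorem sigma01_eq : sigma01 = bitUnit 0 1 := by
  ext i j; fin_cases i <;> fin_cases j <;> simp [sigma01, bitUnit]

theorem sigma10_eq : sigma10 = bitUnit 1 0 := by
  ext i j; fin_cases i <;> fin_cases j <;> simp [sigma10, bitUnit]

/-- The positions of the non-zero entries of the strings in `shiftTerm`. -/
def StringEntry (c d : Fin 2) (u v : SpaceQubit n → Fin 2) (q : SpaceQubit n) : Prop :=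
  (q = (α, k) → u q = c ∧ v q = d) ∧ (q.1 = α ∧ q.2 < k → u q = d ∧ v q = c) ∧
    (¬(q = (α, k)) → ¬(q.1 = α ∧ q.2 < k) → u q = v q)

open Classical in
theorem axisString_apply (c d : Fin 2) (u v : SpaceQubit n → Fin 2) :
    axisString (bitUnit c d) (bitUnit d c) α k u v =
      if ∀ q, StringEntry α k c d u v q then 1 else 0 := by
  have h : ∀ q : SpaceQubit n, (if q.1 = α then (if q.2 = k then bitUnit c d else if q.2 < k then
      bitUnit d c else 1) else 1) (u q) (v q) =
      if StringEntry α k c d u v q then 1 else 0 := by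
    rintro ⟨a, i⟩
    by_cases ha : a = α
    · subst ha
      rcases lt_trichotomy i k with hi | hi | hi
      · simp [StringEntry, bitUnit, hi, hi.ne]
      · subst hi; simp [StringEntry, bitUnit]
      · simp [StringEntry, hi.ne', hi.not_gt, Matrix.one_apply]
    · simp [StringEntry, ha, Matrix.one_apply]
  simp only [axisString, tensorOp, Matrix.of_apply, h, Finset.prod_boole, Finset.mem_univ,
    true_implies]

/-- For a non-zero entry, bit `k` is `c` in `x` and `d` in `y`, while each lower bit is `d` in `x`
and `c` in `y`. Adding bit `k` to the lower ones makes them `c + d = 1` in both states, so after the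
fan-out the states differ only in bit `k` and all lower bits are set. -/
theorem stringEntry_iff {c d : Fin 2} (hcd : c ≠ d) {x y : Qubit n → Fin 2}
    (hx : x (spaceQubit α k) = c) (hy : y (spaceQubit α k) = d) :
    ((fun i => x (Sum.inl i)) = (fun i => y (Sum.inl i)) ∧
      ∀ q, StringEntry α k c d (fun q => x (Sum.inr q)) (fun q => y (Sum.inr q)) q) ↔
    (fanOut (spaceQubit α k) (lowerQubits α k) x =
      Function.update (fanOut (spaceQubit α k) (lowerQubits α k) y) (spaceQubit α k)
        (fanOut (spaceQubit α k) (lowerQubits α k) x (spaceQubit α k)) ∧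
      LowerSet α k (fanOut (spaceQubit α k) (lowerQubits α k) y)) := by
  have hc : c + d = 1 := by omega
  have hdc : d + c = 1 := by omega
  have hlow : ∀ (z : Qubit n → Fin 2) (i : Fin n), i < k →
      fanOut (spaceQubit α k) (lowerQubits α k) z (Sum.inr (α, i)) =
        z (Sum.inr (α, i)) + z (spaceQubit α k) := fun z i hi =>
    if_pos ((mem_lowerQubits α k).2 ⟨i, hi, rfl⟩)
  have hinl : ∀ (z : Qubit n → Fin 2) (i : Fin 4),
      fanOut (spaceQubit α k) (lowerQubits α k) z (Sum.inl i) = z (Sum.inl i) := fun z i =>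
    if_neg (by simp [mem_lowerQubits])
  have hother : ∀ (z : Qubit n → Fin 2) (q : SpaceQubit n), ¬(q.1 = α ∧ q.2 < k) →
      fanOut (spaceQubit α k) (lowerQubits α k) z (Sum.inr q) = z (Sum.inr q) := by
    rintro z ⟨a, i⟩ hq
    refine if_neg ?_
    rw [mem_lowerQubits]
    rintro ⟨j, hj, h⟩
    simp only [Sum.inr.injEq, Prod.mk.injEq] at h
    exact hq ⟨h.1, h.2 ▸ hj⟩
  constructor
  · rintro ⟨h1, h2⟩
    refine ⟨?_, fun i hi => ?_⟩
    · funext r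
      by_cases hr : r = spaceQubit α k
      · subst hr; simp
      · rw [Function.update_of_ne hr]
        rcases r with i | ⟨a, i⟩
        · rw [hinl, hinl]; exact congrFun h1 i
        · obtain ⟨-, h3, h4⟩ := h2 (a, i)
          by_cases hai : a = α ∧ i < k
          · obtain ⟨rfl, hi⟩ := hai
            obtain ⟨h5, h6⟩ := h3 ⟨rfl, hi⟩
            dsimp only at h5 h6
            rw [hlow _ _ hi, hlow _ _ hi, hx, hy, h5, h6, hc, hdc]
          · rw [hother _ _ hai, hother _ _ hai]
            exact h4 (fun h => hr (by rw [spaceQubit, h])) hai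
    · have h3 : y (Sum.inr (α, i)) = c := ((h2 (α, i)).2.1 ⟨rfl, hi⟩).2
      rw [hlow _ _ hi, hy, h3, hc]
  · rintro ⟨h1, h2⟩
    have h3 : ∀ r, r ≠ spaceQubit α k → fanOut (spaceQubit α k) (lowerQubits α k) x r =
        fanOut (spaceQubit α k) (lowerQubits α k) y r := fun r hr => by
      rw [h1, Function.update_of_ne hr]
    refine ⟨?_, fun q => ⟨?_, ?_, ?_⟩⟩
    · funext i
      have := h3 (Sum.inl i) (by simp [spaceQubit])
      rwa [hinl, hinl] at this
    · rintro rfl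
      exact ⟨hx, hy⟩
    · obtain ⟨a, i⟩ := q
      rintro ⟨ha, hi⟩
      dsimp only at ha hi
      subst ha
      have h4 := h2 i hi
      have h5 := h3 (Sum.inr (a, i)) (by simp [spaceQubit, hi.ne])
      rw [h4, hlow _ _ hi, hx] at h5
      rw [hlow _ _ hi, hy] at h4
      dsimp only
      revert h4 h5 hcd
      generalize x (Sum.inr (a, i)) = p
      generalize y (Sum.inr (a, i)) = r
      clear hx hy hc hdc
      revert c d p r
      decide
    · intro hq hq'
      have h4 := h3 (Sum.inr q) (by simpa [spaceQubit] using hq)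
      rwa [hother _ _ hq', hother _ _ hq'] at h4

open Classical in
/-- The shift terms are diagonalized by a fan-out and a one-qubit gate. -/
theorem onRegisters_diagonal_shiftTerm (d : Fin 16 → ℂ) :
    onRegisters (Matrix.diagonal d) (shiftTerm α k) =
      permOp (fanOut (spaceQubit α k) (lowerQubits α k)) *
        muxOp (spaceQubit α k) (fun _ => basisY) *
        (Matrix.diagonal fun y => Complex.I * ((if LowerSet α k y then
          d (stateIndex fun i => y (Sum.inl i)) else 0) * (zSign (y (spaceQubit α k)) : ℂ))) *
        ((muxOp (spaceQubit α k) fun _ => star basisY) *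
        permOp (fanOut (spaceQubit α k) (lowerQubits α k))) := by
  have hinv := fanOut_involutive (spaceQubit_notMem_lowerQubits α k)
  set L := fanOut (spaceQubit α k) (lowerQubits α k) with hL
  set t := spaceQubit α k with ht
  have hstate : ∀ (y : Qubit n → Fin 2) b,
      (fun i => Function.update y t b (Sum.inl i)) = fun i => y (Sum.inl i) := fun y b => by
    funext i
    rw [Function.update_of_ne (by simp [ht, spaceQubit])]
  -- The one-qubit gates and the diagonal collapse to one multiplexed operator, and the fan-out
  -- merely relabels basis states. The identity becomes an entrywise comparison, split according to
  -- bit `t` of the two states.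
  rw [← mul_assoc, mul_assoc (permOp L), mul_assoc (permOp L), permOp_conj hinv,
    diagonal_eq_muxOp t, muxOp_mul _ _ _ (by simp), muxOp_mul _ _ _ (by
      intro y b; simp only [Function.update_idem])]
  have hlow : ∀ y b, LowerSet α k (Function.update y t b) = LowerSet α k y :=
    ignores_lowerSet α k
  simp only [hstate, hlow, Function.update_self,
    basisY_mul_diagonal_mul]
  ext x y
  have hLs : ∀ z : Qubit n → Fin 2, (fun i => L z (Sum.inl i)) = fun i => z (Sum.inl i) :=
    fun z => funext fun i => if_neg (by simp [mem_lowerQubits])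
  have hLt : ∀ z, L z t = z t := fun z => if_neg (spaceQubit_notMem_lowerQubits α k)
  simp only [onRegisters, Matrix.of_apply, Matrix.submatrix_apply, shiftTerm, Matrix.sub_apply,
    sigma01_eq, sigma10_eq, axisString_apply, muxOp, hLs]
  have hst : (stateIndex fun i => x (Sum.inl i)) = (stateIndex fun i => y (Sum.inl i)) ↔
      (fun i => x (Sum.inl i)) = fun i => y (Sum.inl i) := stateEquiv.injective.eq_iff
  have hno : ∀ {c d : Fin 2}, ¬(x t = c ∧ y t = d) → ¬∀ q, StringEntry α k c d
      (fun q => x (Sum.inr q)) (fun q => y (Sum.inr q)) q := fun h h' => h ((h' (α, k)).1 rfl)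
  rw [hLt, hLt, Matrix.diagonal_apply]
  by_cases hx : x t = 0 <;> by_cases hy : y t = 0
  · rw [if_neg (hno (by simp [hy])), if_neg (hno (by simp [hx]))]
    simp [hx, hy, zSign]
  · replace hy : y t = 1 := by omega
    have h := stringEntry_iff α k (by decide) hx hy
    rw [← hst, ← ht, ← hL, hLt] at h
    rw [if_neg (hno (c := 1) (by simp [hx]))]
    by_cases hP : L x = Function.update (L y) t (x t) ∧ LowerSet α k (L y)
    · have hA := h.2 hP
      rw [if_pos hA.1, if_pos hA.2, if_pos hP.1]
      simp [hP.2, hx, hy, hA.1, zSign]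
      ring_nf
      simp
    · have hA := mt h.1 hP
      rw [not_and_or] at hP hA
      split_ifs <;> simp_all
  · replace hx : x t = 1 := by omega
    have h := stringEntry_iff α k (by decide) hx hy
    rw [← hst, ← ht, ← hL, hLt] at h
    rw [if_neg (hno (c := 0) (by simp [hx]))]
    by_cases hP : L x = Function.update (L y) t (x t) ∧ LowerSet α k (L y)
    · have hA := h.2 hP
      rw [if_pos hA.1, if_pos hA.2, if_pos hP.1]
      simp [hP.2, hx, hy, hA.1, zSign]
      ring_nf
      simp
    · have hA := mt h.1 hP
      rw [not_and_or] at hP hA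
      split_ifs <;> simp_all
  · rw [if_neg (hno (by simp [hx])), if_neg (hno (by simp [hy]))]
    replace hx : x t = 1 := by omega
    replace hy : y t = 1 := by omega
    simp [hx, hy, zSign]

end

/-! ### The circuit for one step -/

section

variable {n : ℕ} (α : Fin 3) (k : Fin n)

/-- The change of basis which diagonalizes the shift terms. -/
def shiftBasis : Matrix (Qubit n → Fin 2) (Qubit n → Fin 2) ℂ :=
  permOp (fanOut (spaceQubit α k) (lowerQubits α k)) * muxOp (spaceQubit α k) (fun _ => basisY)

theorem star_shiftBasis : star (shiftBasis α k) = (muxOp (spaceQubit α k) fun _ => star basisY) *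
    permOp (fanOut (spaceQubit α k) (lowerQubits α k)) := by
  rw [shiftBasis, star_mul, star_permOp (fanOut_involutive (spaceQubit_notMem_lowerQubits α k)),
    star_muxOp_const]

theorem shiftBasis_mul_star : shiftBasis α k * star (shiftBasis α k) = 1 := by
  rw [star_shiftBasis, shiftBasis]
  calc _ = permOp (fanOut (spaceQubit α k) (lowerQubits α k)) *
        ((muxOp (spaceQubit α k) (fun _ => basisY)) *
          (muxOp (spaceQubit α k) fun _ => star basisY)) *
        permOp (fanOut (spaceQubit α k) (lowerQubits α k)) := by simp only [mul_assoc]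
    _ = 1 := by
        rw [muxOp_const_mul_star _ basisY_mem_unitaryGroup, mul_one,
          permOp_mul_self (fanOut_involutive (spaceQubit_notMem_lowerQubits α k))]

theorem HasCost.shiftBasis : HasCost (shiftBasis α k) k :=
  ((HasCost.fanOut _ (spaceQubit_notMem_lowerQubits α k)).mul
    (HasCost.single _ basisY_mem_unitaryGroup)).mono (card_lowerQubits_le α k)

theorem HasCost.star_shiftBasis : HasCost (star (ElasticWave.shiftBasis α k)) k := by
  rw [ElasticWave.star_shiftBasis]
  exact ((HasCost.single _ (Unitary.star_mem basisY_mem_unitaryGroup)).mul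
    (HasCost.fanOut _ (spaceQubit_notMem_lowerQubits α k))).mono
      (by rw [zero_add]; exact card_lowerQubits_le α k)

open Classical in
/-- The diagonal form of the exponential of one term. -/
def phaseGate (θ : Fin 16 → ℝ) : Matrix (Qubit n → Fin 2) (Qubit n → Fin 2) ℂ :=
  Matrix.diagonal fun y => Complex.exp (Complex.I * (((if LowerSet α k y then
    θ (stateIndex fun i => y (Sum.inl i)) else 0) * zSign (y (spaceQubit α k)) : ℝ) : ℂ))

theorem HasCost.phaseGate (θ : Fin 16 → ℝ) : HasCost (phaseGate α k θ) (60 + 64 * (k : ℕ)) := by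
  -- The angle depends on the four state qubits, so each of the two rotations costs `2 ^ 5 - 2 =
  -- 30`; each of the two flips costs `32 k`.
  have h := HasCost.controlledMuxZ (ignores_lowerSet α k) (HasCost.lowerSet α k)
    (s := Finset.univ.image Sum.inl) (by simp [spaceQubit])
    (fun y => θ (stateIndex fun i => y (Sum.inl i))) (by
      intro x y h
      dsimp only
      congr 2
      funext i
      exact h _ (by simp))
  rw [Finset.card_image_of_injective _ Sum.inl_injective, Finset.card_univ, Fintype.card_fin] at h
  exact h.mono (by norm_num; omega)

/-- The exponential of one term in the eigenbasis of the state register. -/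
def axisGate (θ : Fin 16 → ℝ) : Matrix (Qubit n → Fin 2) (Qubit n → Fin 2) ℂ :=
  shiftBasis α k * phaseGate α k θ * star (shiftBasis α k)

theorem HasCost.axisGate (θ : Fin 16 → ℝ) : HasCost (axisGate α k θ) (66 * (k : ℕ) + 60) :=
  (((HasCost.shiftBasis α k).mul (HasCost.phaseGate α k θ)).mul
    (HasCost.star_shiftBasis α k)).mono (by omega)

variable {ρ : ℝ} {S : Matrix (Fin 6) (Fin 6) ℝ} (E : Eigendecomposition ρ S)

/-- The change of basis to the eigenvectors on the state register. -/
def Eigendecomposition.basisOp (n : ℕ) (α : Fin 3) :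
    Matrix (Qubit n → Fin 2) (Qubit n → Fin 2) ℂ :=
  onRegisters (basisMatrix (E.vec α)) 1

theorem Eigendecomposition.star_basisOp (n : ℕ) :
    star (E.basisOp n α) = onRegisters (star (basisMatrix (E.vec α))) 1 := by
  rw [Eigendecomposition.basisOp, star_onRegisters, star_one]

theorem Eigendecomposition.basisOp_mul_star (n : ℕ) :
    E.basisOp n α * star (E.basisOp n α) = 1 := by
  rw [E.star_basisOp, Eigendecomposition.basisOp, ← onRegisters_mul,
    Matrix.mem_unitaryGroup_iff.1 (basisMatrix_mem_unitaryGroup _), mul_one, onRegisters_one]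

theorem Eigendecomposition.axisTerm_eq (h : ℝ) :
    axisTerm n h ρ S α k = E.basisOp n α * onRegisters (Matrix.diagonal fun j => (E.val α j : ℂ))
      ((Complex.I / (2 * (h : ℂ))) • shiftTerm α k) * star (E.basisOp n α) := by
  rw [E.star_basisOp, Eigendecomposition.basisOp, ← onRegisters_mul, ← onRegisters_mul, one_mul,
    mul_one, ← E.stateMat_eq, axisTerm]

theorem Eigendecomposition.evolution_axisTerm (h t : ℝ) :
    evolution (axisTerm n h ρ S α k) t = E.basisOp n α *
      axisGate α k (fun j => t / (2 * h) * E.val α j) * star (E.basisOp n α) := by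
  have hV : (E.basisOp n α * shiftBasis α k) * (star (shiftBasis α k) * star (E.basisOp n α)) =
      1 := by
    calc _ = E.basisOp n α * (shiftBasis α k * star (shiftBasis α k)) * star (E.basisOp n α) := by
          simp only [mul_assoc]
      _ = 1 := by rw [shiftBasis_mul_star, mul_one, E.basisOp_mul_star]
  rw [evolution, E.axisTerm_eq α k h, onRegisters_smul_right, onRegisters_diagonal_shiftTerm,
    ← shiftBasis, ← star_shiftBasis]
  classical
  set d : (Qubit n → Fin 2) → ℂ := fun y => Complex.I * ((if LowerSet α k y then
          (E.val α (stateIndex fun i => y (Sum.inl i)) : ℂ) else 0) *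
            (zSign (y (spaceQubit α k)) : ℂ)) with hd
  have he : (-(Complex.I * (t : ℂ))) • (E.basisOp n α * ((Complex.I / (2 * (h : ℂ))) •
      (shiftBasis α k * Matrix.diagonal d * star (shiftBasis α k))) * star (E.basisOp n α)) =
      (E.basisOp n α * shiftBasis α k) *
        Matrix.diagonal ((-(Complex.I * (t : ℂ)) * (Complex.I / (2 * (h : ℂ)))) • d) *
        (star (shiftBasis α k) * star (E.basisOp n α)) := by
    rw [Matrix.diagonal_smul]
    simp only [Matrix.mul_smul, Matrix.smul_mul, smul_smul, mul_assoc]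
  rw [he, exp_mul_diagonal_mul hV, axisGate, phaseGate]
  simp only [mul_assoc]
  congr 4
  funext y
  congr 1
  rw [Pi.smul_apply, hd, smul_eq_mul]
  -- The factor `i` in the Hamiltonian cancels the one in the exponent, which leaves real angles `t
  -- λ_j / 2h`.
  have hI : -(Complex.I * (t : ℂ)) * (Complex.I / (2 * (h : ℂ))) = t / (2 * h) := by
    rw [neg_mul, mul_div_assoc', mul_right_comm, Complex.I_mul_I]
    ring
  rw [hI]
  by_cases hl : LowerSet α k y
  · simp only [hl, if_true]; push_cast; ring
  · simp only [hl, if_false]; push_cast; ring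

theorem list_sum_gateCost (n : ℕ) :
    ((List.finRange n).map fun k : Fin n => 66 * (k : ℕ) + 60).sum = 33 * n ^ 2 + 27 * n := by
  rw [← Fin.sum_univ_def, Fin.sum_univ_eq_sum_range fun k => 66 * k + 60]
  induction n with
  | zero => simp
  | succ n ih => rw [Finset.sum_range_succ, ih]; ring

theorem HasCost.axisGates (θ : Fin 16 → ℝ) :
    HasCost ((List.finRange n).map fun k => ElasticWave.axisGate α k θ).prod
      (33 * n ^ 2 + 27 * n) :=
  (HasCost.list_prod _ _ _ fun k _ => HasCost.axisGate α k θ).mono (list_sum_gateCost n).le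

theorem HasCost.axisGates_reverse (θ : Fin 16 → ℝ) :
    HasCost ((List.finRange n).reverse.map fun k => ElasticWave.axisGate α k θ).prod
      (33 * n ^ 2 + 27 * n) := by
  refine (HasCost.list_prod _ _ _ fun k _ => HasCost.axisGate α k θ).mono ?_
  rw [List.map_reverse, List.sum_reverse]
  exact (list_sum_gateCost n).le

theorem Eigendecomposition.axisFactors_prod (h t : ℝ) :
    (axisFactors n h ρ S t α).prod = E.basisOp n α *
      ((List.finRange n).map fun k => axisGate α k fun j => t / (2 * h) * E.val α j).prod *
        star (E.basisOp n α) := by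
  rw [← prod_map_conj _ _ (E.basisOp_mul_star α n) (mul_eq_one_comm.1 (E.basisOp_mul_star α n)),
    axisFactors]
  simp only [E.evolution_axisTerm]

theorem Eigendecomposition.axisFactors_reverse_prod (h t : ℝ) :
    (axisFactors n h ρ S t α).reverse.prod = E.basisOp n α *
      ((List.finRange n).reverse.map fun k => axisGate α k fun j =>
        t / (2 * h) * E.val α j).prod * star (E.basisOp n α) := by
  rw [← prod_map_conj _ _ (E.basisOp_mul_star α n) (mul_eq_one_comm.1 (E.basisOp_mul_star α n)),
    axisFactors, ← List.map_reverse]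
  simp only [E.evolution_axisTerm]

/-- The CNOT count of one Trotter step. -/
theorem Eigendecomposition.hasCost_trotter2 (n : ℕ) (h τ : ℝ) :
    HasCost (E.trotter2 n h τ) (198 * n ^ 2 + 162 * n + 1260) := by
  have hV : ∀ α, HasCost (E.basisOp n α) 210 := fun α =>
    HasCost.onRegisters (basisMatrix_mem_unitaryGroup _)
  have hV' : ∀ α, HasCost (star (E.basisOp n α)) 210 := fun α => by
    rw [E.star_basisOp]
    exact HasCost.onRegisters (Unitary.star_mem (basisMatrix_mem_unitaryGroup _))
  have hVV : ∀ α β, HasCost (star (E.basisOp n α) * E.basisOp n β) 210 := fun α β => by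
    rw [E.star_basisOp, Eigendecomposition.basisOp, ← onRegisters_mul, mul_one]
    exact HasCost.onRegisters (mul_mem (Unitary.star_mem (basisMatrix_mem_unitaryGroup _))
      (basisMatrix_mem_unitaryGroup _))
  have hF : (List.finRange 3) = [0, 1, 2] := by decide
  rw [E.trotter2_eq, hF]
  simp only [List.flatMap_cons, List.flatMap_nil, List.append_nil, List.reverse_append,
    List.prod_append, E.axisFactors_prod, E.axisFactors_reverse_prod]
  have hG := fun α => HasCost.axisGates (n := n) α fun j => τ / 2 / (2 * h) * E.val α j
  have hR := fun α => HasCost.axisGates_reverse (n := n) α fun j => τ / 2 / (2 * h) * E.val α j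
  generalize hGdef : (fun α => ((List.finRange n).map fun k =>
    axisGate α k fun j => τ / 2 / (2 * h) * E.val α j).prod) = G at *
  have hG' : ∀ α, ((List.finRange n).map fun k =>
    axisGate α k fun j => τ / 2 / (2 * h) * E.val α j).prod = G α := fun α => by rw [← hGdef]
  generalize hRdef : (fun α => ((List.finRange n).reverse.map fun k =>
    axisGate α k fun j => τ / 2 / (2 * h) * E.val α j).prod) = R at *
  have hR' : ∀ α, ((List.finRange n).reverse.map fun k =>
    axisGate α k fun j => τ / 2 / (2 * h) * E.val α j).prod = R α := fun α => by rw [← hRdef]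
  simp only [hG', hR'] at hG hR ⊢
  -- Six products over `k` cost `6 (33n² + 27n)`. Changes of eigenbasis between different axes merge
  -- into one four-qubit unitary, and the two in the middle, both for axis 0, cancel. Six of cost
  -- 210 remain, in total 1260.
  refine ((((((((((((hV 2).mul (hR 2)).mul (hVV 2 1)).mul (hR 1)).mul (hVV 1 0)).mul
    (hR 0)).mul (hG 0)).mul (hVV 0 1)).mul (hG 1)).mul (hVV 1 2)).mul (hG 2)).mul
    (hV' 2)).of_eq ?_ (by ring_nf; rfl)
  have h0 : ∀ X, star (E.basisOp n 0) * (E.basisOp n 0 * X) = X := fun X => by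
    rw [← mul_assoc, mul_eq_one_comm.1 (E.basisOp_mul_star 0 n), one_mul]
  simp only [mul_assoc, h0]

end

/-! ### Inverse square roots -/

section

variable {ι : Type*} [Fintype ι] [DecidableEq ι]

/-- The square of a self-adjoint matrix is positive, so a self-adjoint fourth root of the inverse
identifies the positive square root with no separate positivity argument. The hypotheses are
algebraic and survive tensoring with the identity, block sums and the passage from real to complex
matrices. In the proof `X` itself is written as a function of `Q`. -/
theorem invSqrt_eq {X Q : Matrix ι ι ℂ} (hQ : star Q = Q) (h : Q * Q * (Q * Q) * X = 1) :
    invSqrt X = Q * Q := by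
  have hsa : IsSelfAdjoint Q := hQ
  have hfin : (spectrum ℝ Q).Finite := Q.finite_real_spectrum
  have h0 : ∀ x ∈ spectrum ℝ Q, x ≠ 0 := by
    rintro x hx rfl
    rw [spectrum.zero_mem_iff] at hx
    refine hx ⟨⟨Q, Q * (Q * Q) * X, ?_, mul_eq_one_comm.1 ?_⟩, rfl⟩ <;>
      simpa only [mul_assoc] using h
  have hQ2 : cfc (fun x : ℝ => x * x) Q = Q * Q := by
    rw [cfc_mul _ _ Q (hfin.continuousOn _) (hfin.continuousOn _), cfc_id' ℝ Q]
  have hX : cfc (fun x : ℝ => (x * x * (x * x))⁻¹) Q = X := by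
    have h1 : Q * Q * (Q * Q) * cfc (fun x : ℝ => (x * x * (x * x))⁻¹) Q = 1 := by
      rw [← hQ2, ← cfc_mul _ _ Q (hfin.continuousOn _) (hfin.continuousOn _),
        ← cfc_mul _ _ Q (hfin.continuousOn _) (hfin.continuousOn _)]
      rw [← cfc_one ℝ Q]
      refine cfc_congr fun x hx => ?_
      have := h0 x hx
      simp only [Pi.one_apply]
      field_simp
    calc _ = (X * (Q * Q * (Q * Q))) * cfc (fun x : ℝ => (x * x * (x * x))⁻¹) Q := by
          rw [mul_eq_one_comm.1 h, one_mul]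
      _ = X := by rw [mul_assoc, h1, mul_one]
  rw [invSqrt, ← hX, ← cfc_comp' _ _ Q ((hfin.image _).continuousOn _) (hfin.continuousOn _), ← hQ2]
  refine cfc_congr fun x hx => ?_
  have hx0 := h0 x hx
  have h1 : 0 ≤ x * x := mul_self_nonneg x
  rw [Real.inv_rpow (by positivity), Real.rpow_neg (by positivity), inv_inv, ← Real.sqrt_eq_rpow,
    Real.sqrt_mul_self h1]

theorem exists_selfAdjoint_pow_four_mul {X : Matrix ι ι ℝ} (hX : X.PosDef) :
    ∃ Q : Matrix ι ι ℝ, star Q = Q ∧ Q * Q * (Q * Q) * X = 1 := by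
  have hsa : IsSelfAdjoint X := hX.1
  have hfin : (spectrum ℝ X).Finite := X.finite_real_spectrum
  have hpos : ∀ x ∈ spectrum ℝ X, 0 < x := by
    intro x hx
    rw [hX.1.spectrum_real_eq_range_eigenvalues] at hx
    obtain ⟨i, rfl⟩ := hx
    exact hX.eigenvalues_pos i
  refine ⟨cfc (fun x : ℝ => x ^ (-(1 / 4) : ℝ)) X, ?_, ?_⟩
  · exact (cfc_predicate (fun x : ℝ => x ^ (-(1 / 4) : ℝ)) X : IsSelfAdjoint _)
  · nth_rw 5 [← cfc_id' ℝ X]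
    rw [← cfc_mul _ _ X (hfin.continuousOn _) (hfin.continuousOn _),
      ← cfc_mul _ _ X (hfin.continuousOn _) (hfin.continuousOn _),
      ← cfc_mul _ _ X (hfin.continuousOn _) (hfin.continuousOn _), ← cfc_one ℝ X]
    refine cfc_congr fun x hx => ?_
    have := hpos x hx
    rw [← Real.rpow_add this, ← Real.rpow_add this]
    nth_rw 2 [← Real.rpow_one x]
    rw [← Real.rpow_add this]
    norm_num

/-- A real matrix acts separately on the real and imaginary parts, and the squared norms add. -/
theorem norm_map_ofReal_le (A : Matrix ι ι ℝ) : ‖A.map fun x => (x : ℂ)‖ ≤ ‖A‖ := by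
  rw [Matrix.cstar_norm_def]
  refine ContinuousLinearMap.opNorm_le_bound _ (norm_nonneg _) fun z => ?_
  set x : EuclideanSpace ℝ ι := WithLp.toLp 2 fun i => (z i).re with hx
  set y : EuclideanSpace ℝ ι := WithLp.toLp 2 fun i => (z i).im with hy
  have hzn : ‖z‖ ^ 2 = ‖x‖ ^ 2 + ‖y‖ ^ 2 := by
    simp only [EuclideanSpace.norm_sq_eq, hx, hy, ← Finset.sum_add_distrib]
    refine Finset.sum_congr rfl fun i _ => ?_
    rw [← Complex.normSq_eq_norm_sq, Complex.normSq_apply, Real.norm_eq_abs, Real.norm_eq_abs,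
      sq_abs, sq_abs]
    ring
  have hAz : ‖Matrix.toEuclideanCLM (n := ι) (𝕜 := ℂ) (A.map fun x => (x : ℂ)) z‖ ^ 2 =
      ‖Matrix.toEuclideanCLM (n := ι) (𝕜 := ℝ) A x‖ ^ 2 +
        ‖Matrix.toEuclideanCLM (n := ι) (𝕜 := ℝ) A y‖ ^ 2 := by
    simp only [EuclideanSpace.norm_sq_eq, Matrix.ofLp_toEuclideanCLM, ← Finset.sum_add_distrib]
    refine Finset.sum_congr rfl fun i _ => ?_
    rw [← Complex.normSq_eq_norm_sq, Complex.normSq_apply, Real.norm_eq_abs, Real.norm_eq_abs,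
      sq_abs, sq_abs]
    simp [Matrix.mulVec, dotProduct, hx, hy]
    ring
  have h1 := (Matrix.toEuclideanCLM (n := ι) (𝕜 := ℝ) A).le_opNorm x
  have h2 := (Matrix.toEuclideanCLM (n := ι) (𝕜 := ℝ) A).le_opNorm y
  rw [← Matrix.cstar_norm_def] at h1 h2
  refine abs_le_of_sq_le_sq' ?_ (by positivity) |>.2
  rw [hAz, mul_pow, hzn, mul_add, ← mul_pow, ← mul_pow]
  gcongr

end

/-! ### Norms of the terms -/

section

open Matrix

theorem cMat_mul_transpose (α : Fin 3) : cMat α * (cMat α).transpose = 1 := by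
  fin_cases α <;> ext i j <;> fin_cases i <;> fin_cases j <;>
    simp [cMat, mul_apply, Fin.sum_univ_succ]

theorem cMat_conjTranspose (α : Fin 3) : (cMat α)ᴴ = (cMat α).transpose := by
  fin_cases α <;> ext i j <;> fin_cases i <;> fin_cases j <;> simp [cMat]

/-- A matrix on the six stress components of the state register. -/
def stressBlock : Matrix (Fin 6) (Fin 6) ℂ →⋆ₙₐ[ℂ] Matrix (Fin 16) (Fin 16) ℂ where
  toFun X := reindex blockEquiv blockEquiv (fromBlocks 0 0 0 (fromBlocks X 0 0 0))
  map_smul' c X := by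
    ext i j
    rcases hi : blockEquiv.symm i with _ | _ | _ <;> rcases hj : blockEquiv.symm j with _ | _ | _ <;>
      simp [hi, hj]
  map_zero' := by simp
  map_add' X Y := by
    ext i j
    rcases hi : blockEquiv.symm i with _ | _ | _ <;> rcases hj : blockEquiv.symm j with _ | _ | _ <;>
      simp [hi, hj]
  map_mul' X Y := by
    simp [fromBlocks_multiply]
  map_star' X := by
    simp [star_eq_conjTranspose, conjTranspose_submatrix, fromBlocks_conjTranspose]

theorem star_aCell (α : Fin 3) : star (aCell α) = aCell α := by
  rw [aCell, star_eq_conjTranspose, conjTranspose_reindex, fromBlocks_conjTranspose,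
    conjTranspose_fromCols_eq_fromRows_conjTranspose,
    conjTranspose_fromRows_eq_fromCols_conjTranspose, ← cMat_conjTranspose]
  simp

theorem aCell_mul_self_mul (α : Fin 3) : aCell α * aCell α * aCell α = aCell α := by
  simp only [aCell, reindex_apply, submatrix_mul_equiv, fromBlocks_multiply]
  congr 2
  all_goals simp [fromCols_mul_fromRows, cMat_mul_transpose, Matrix.mul_assoc]

/-- From `A³ = A` the self-adjoint matrix `A²` is idempotent. The C*-identity then gives `‖A²‖ =
‖A²‖²` and `‖A²‖ = ‖A‖²`. -/
theorem norm_aCell_le (α : Fin 3) : ‖aCell α‖ ≤ 1 := by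
  have h1 : ‖aCell α * aCell α‖ = ‖aCell α‖ * ‖aCell α‖ := by
    have := CStarRing.norm_star_mul_self (x := aCell α)
    rwa [star_aCell] at this
  have h2 : ‖aCell α * aCell α‖ = ‖aCell α * aCell α‖ * ‖aCell α * aCell α‖ := by
    have := CStarRing.norm_star_mul_self (x := aCell α * aCell α)
    rwa [star_mul, star_aCell, ← mul_assoc, aCell_mul_self_mul] at this
  have h3 := norm_nonneg (aCell α)
  rw [h1] at h2
  by_contra h
  push Not at h
  have h4 : 1 < ‖aCell α‖ * ‖aCell α‖ := by nlinarith
  nlinarith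

/-- The constant `ρ^{-1/2} ‖S⁻¹‖^{1/2}`. -/
def waveSpeed (ρ : ℝ) (S : Matrix (Fin 6) (Fin 6) ℝ) : ℝ :=
  ρ ^ (-(1 / 2) : ℝ) * ‖S⁻¹‖ ^ (1 / 2 : ℝ)

/-- The fourth root is taken blockwise; `R` is the complex version of `S^{-1/2}`, whose norm follows
from the C*-identity. -/
theorem exists_bCell_root {ρ : ℝ} (hρ : 0 < ρ) {S : Matrix (Fin 6) (Fin 6) ℝ} (hS : S.PosDef) :
    ∃ (Q : Matrix (Fin 16) (Fin 16) ℂ) (R : Matrix (Fin 6) (Fin 6) ℂ), star Q = Q ∧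
      Q * Q * (Q * Q) * bCell ρ S = 1 ∧ ‖R‖ ≤ ‖S⁻¹‖ ^ (1 / 2 : ℝ) ∧
      Q * Q = reindex blockEquiv blockEquiv (fromBlocks (((ρ ^ (-(1 / 2) : ℝ) : ℝ) : ℂ) • 1) 0 0
        (fromBlocks R 0 0 1)) := by
  obtain ⟨P, hP, hPS⟩ := exists_selfAdjoint_pow_four_mul hS
  have hPP : P * P * (P * P) = S⁻¹ := (inv_eq_left_inv hPS).symm
  set f : Matrix (Fin 6) (Fin 6) ℝ → Matrix (Fin 6) (Fin 6) ℂ := fun A => A.map fun x => (x : ℂ)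
    with hf
  have hmul : ∀ A B, f (A * B) = f A * f B := fun A B =>
    map_mul Complex.ofRealHom.mapMatrix A B
  have hone : f 1 = 1 := map_one Complex.ofRealHom.mapMatrix
  set r : ℝ := ρ ^ (-(1 / 4) : ℝ) with hr
  have hr2 : r * r = ρ ^ (-(1 / 2) : ℝ) := by
    rw [hr, ← Real.rpow_add hρ]; norm_num
  have hr4 : r * r * (r * r) * ρ = 1 := by
    rw [hr2, ← Real.rpow_add hρ]
    nth_rw 2 [← Real.rpow_one ρ]
    rw [← Real.rpow_add hρ]; norm_num
  refine ⟨reindex blockEquiv blockEquiv (fromBlocks ((r : ℂ) • 1) 0 0 (fromBlocks (f P) 0 0 1)),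
    f (P * P), ?_, ?_, ?_, ?_⟩
  · have hfP : (f P)ᴴ = f P := by
      ext i j
      have := congrFun (congrFun hP i) j
      simp only [star_apply, star_trivial] at this
      simp [hf, this]
    rw [star_eq_conjTranspose, conjTranspose_reindex, fromBlocks_conjTranspose,
      fromBlocks_conjTranspose, hfP]
    simp [conjTranspose_smul]
  · have h4 : f P * f P * (f P * f P) * f S = 1 := by rw [← hmul, ← hmul, ← hmul, hPS, hone]
    have hr4' : (r : ℂ) * r * (r * r) * ρ = 1 := by exact_mod_cast hr4
    simp only [bCell, reindex_apply, submatrix_mul_equiv, fromBlocks_multiply, Matrix.mul_zero,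
      Matrix.zero_mul, add_zero, zero_add, Matrix.mul_one]
    have h5 : (S.map fun x => (x : ℂ)) = f S := rfl
    rw [h5, h4]
    have h6 : ((r : ℂ) • (1 : Matrix (Fin 3) (Fin 3) ℂ)) * ((r : ℂ) • 1) *
        (((r : ℂ) • 1) * ((r : ℂ) • 1)) * ((ρ : ℂ) • 1) = 1 := by
      simp only [Matrix.mul_smul, Matrix.mul_one, smul_smul]
      trans ((r : ℂ) * r * (r * r) * ρ) • (1 : Matrix (Fin 3) (Fin 3) ℂ)
      · congr 1
        ring
      · rw [hr4', one_smul]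
    rw [h6, fromBlocks_one, fromBlocks_one, submatrix_one_equiv]
  · have hPPsa : star (P * P) = P * P := by rw [star_mul, hP]
    have h1 : ‖P * P‖ * ‖P * P‖ = ‖S⁻¹‖ := by
      have := CStarRing.norm_star_mul_self (x := P * P)
      rw [hPPsa, hPP] at this
      exact this.symm
    refine (norm_map_ofReal_le _).trans (le_of_eq ?_)
    rw [← h1, ← Real.sqrt_eq_rpow, Real.sqrt_mul_self (norm_nonneg _)]
  · simp only [reindex_apply, submatrix_mul_equiv, fromBlocks_multiply, Matrix.mul_zero,
      Matrix.zero_mul, add_zero, zero_add, Matrix.mul_one, hmul, Matrix.mul_smul, smul_smul, smul_zero, ← hr2]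
    push_cast
    rfl

theorem norm_stateMat_le {ρ : ℝ} (hρ : 0 < ρ) {S : Matrix (Fin 6) (Fin 6) ℝ} (hS : S.PosDef)
    (α : Fin 3) : ‖stateMat ρ S α‖ ≤ 2 * waveSpeed ρ S := by
  obtain ⟨Q, R, hQ, hQB, hR, hQQ⟩ := exists_bCell_root hρ hS
  set r : ℝ := ρ ^ (-(1 / 2) : ℝ) with hr
  -- The matrix `A^{(α)}` only couples velocities with stresses, so conjugation multiplies one
  -- off-diagonal block by `R` on the right and the other by `R` on the left. Bounding the two
  -- blocks separately costs the factor 2 in the statement, which later cancels against `1 / 2h`.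
  have hM : stateMat ρ S α = (r : ℂ) • (aCell α * stressBlock R + stressBlock R * aCell α) := by
    rw [stateMat, invSqrt_eq hQ hQB, hQQ]
    show _ = (r : ℂ) • (aCell α * reindex blockEquiv blockEquiv
      (fromBlocks 0 0 0 (fromBlocks R 0 0 0)) + reindex blockEquiv blockEquiv
      (fromBlocks 0 0 0 (fromBlocks R 0 0 0)) * aCell α)
    have hadd : ∀ M N : Matrix (Fin 3 ⊕ (Fin 6 ⊕ Fin 7)) (Fin 3 ⊕ (Fin 6 ⊕ Fin 7)) ℂ,
        M.submatrix blockEquiv.symm blockEquiv.symm + N.submatrix blockEquiv.symm blockEquiv.symm =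
          (M + N).submatrix blockEquiv.symm blockEquiv.symm := fun _ _ => rfl
    have hsmul : ∀ M : Matrix (Fin 3 ⊕ (Fin 6 ⊕ Fin 7)) (Fin 3 ⊕ (Fin 6 ⊕ Fin 7)) ℂ,
        (r : ℂ) • M.submatrix blockEquiv.symm blockEquiv.symm =
          ((r : ℂ) • M).submatrix blockEquiv.symm blockEquiv.symm := fun _ => rfl
    simp only [aCell, reindex_apply, submatrix_mul_equiv, fromBlocks_multiply, hadd, hsmul]
    congr 1
    simp [fromBlocks_add, fromBlocks_smul, fromCols_mul_fromBlocks, fromBlocks_mul_fromRows]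
  -- A *-homomorphism of C*-algebras is contractive, even if it is not unital.
  have hN : ‖stressBlock R‖ ≤ ‖R‖ := NonUnitalStarAlgHom.norm_apply_le stressBlock R
  have hA := norm_aCell_le α
  have hr0 : 0 ≤ r := by positivity
  rw [hM, norm_smul, Complex.norm_real, Real.norm_of_nonneg hr0, waveSpeed]
  calc r * ‖aCell α * stressBlock R + stressBlock R * aCell α‖ ≤
        r * (‖aCell α‖ * ‖stressBlock R‖ + ‖stressBlock R‖ * ‖aCell α‖) := by
        gcongr
        exact (norm_add_le _ _).trans (add_le_add (norm_mul_le _ _) (norm_mul_le _ _))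
    _ ≤ r * (1 * ‖S⁻¹‖ ^ (1 / 2 : ℝ) + ‖S⁻¹‖ ^ (1 / 2 : ℝ) * 1) := by
        gcongr <;> exact hN.trans hR
    _ = _ := by ring

end

/-! ### The Trotter error -/

section

variable {ρ : ℝ} {S : Matrix (Fin 6) (Fin 6) ℝ}

/-- The root `Q` of the cell matrix yields the root `Q ⊗ 1` of `B`, so the inverse square root acts
on the state register alone. -/
theorem hamiltonian_eq (n : ℕ) (h : ℝ) (hρ : 0 < ρ) (hS : S.PosDef) :
    hamiltonian n h ρ S = ∑ α, ∑ k, axisTerm n h ρ S α k := by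
  obtain ⟨Q, R, hQ, hQB, -, -⟩ := exists_bCell_root hρ hS
  have h1 : invSqrt (bFull n ρ S) = onRegisters (invSqrt (bCell ρ S)) 1 := by
    rw [invSqrt_eq hQ hQB, invSqrt_eq (Q := onRegisters Q 1), ← onRegisters_mul, mul_one]
    · rw [star_onRegisters, hQ, star_one]
    · rw [bFull]
      simp only [← onRegisters_mul, mul_one, hQB, onRegisters_one]
  rw [hamiltonian, h1, aFull, Finset.mul_sum, Finset.sum_mul, Finset.smul_sum]
  refine Finset.sum_congr rfl fun α _ => ?_
  rw [← onRegisters_mul, ← onRegisters_mul, one_mul, mul_one, ← stateMat, diffOp,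
    ← onRegisters_smul_right, Finset.smul_sum, Finset.smul_sum, onRegisters_sum_right]
  refine Finset.sum_congr rfl fun k _ => ?_
  rw [axisTerm, smul_smul, mul_one_div]

variable {n : ℕ}

theorem Eigendecomposition.abs_val_le (E : Eigendecomposition ρ S)
    (hρ : 0 < ρ) (hS : S.PosDef) (α : Fin 3) (j : Fin 16) :
    |E.val α j| ≤ 2 * waveSpeed ρ S := by
  have hV := basisMatrix_mem_unitaryGroup (E.vec α)
  have hd : ‖Matrix.diagonal fun j => (E.val α j : ℂ)‖ = ‖stateMat ρ S α‖ := by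
    rw [E.stateMat_eq, CStarRing.norm_mul_mem_unitary _ (Unitary.star_mem hV),
      CStarRing.norm_mem_unitary_mul _ hV]
  rw [Matrix.l2_opNorm_diagonal] at hd
  have h1 := norm_le_pi_norm (fun j => (E.val α j : ℂ)) j
  rw [Complex.norm_real, Real.norm_eq_abs, hd] at h1
  exact h1.trans (norm_stateMat_le hρ hS α)

/-- The eigenvalues are `±λ_j / 2h` and zero; with `|λ_j| ≤ 2w` they are at most `w / h`. -/
theorem Eigendecomposition.exists_diagonal_axisTerm (E : Eigendecomposition ρ S)
    (hρ : 0 < ρ) (hS : S.PosDef) {h : ℝ}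
    (hh : 0 < h) (α : Fin 3) (k : Fin n) :
    ∃ U ∈ Matrix.unitaryGroup (Qubit n → Fin 2) ℂ, ∃ d : (Qubit n → Fin 2) → ℝ,
      (∀ y, |d y| ≤ waveSpeed ρ S / h) ∧
        axisTerm n h ρ S α k = U * Matrix.diagonal (fun y => (d y : ℂ)) * star U := by
  classical
  have hU : E.basisOp n α * shiftBasis α k ∈ Matrix.unitaryGroup (Qubit n → Fin 2) ℂ :=
    mul_mem (Matrix.mem_unitaryGroup_iff.2 (E.basisOp_mul_star α n))
      (Matrix.mem_unitaryGroup_iff.2 (shiftBasis_mul_star α k))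
  refine ⟨_, hU, fun y => -(1 / (2 * h)) * ((if LowerSet α k y then
    E.val α (stateIndex fun i => y (Sum.inl i)) else 0) * zSign (y (spaceQubit α k))),
    fun y => ?_, ?_⟩
  · have hz : |zSign (y (spaceQubit α k))| = 1 := by
      rw [zSign]; split_ifs <;> simp
    have hw : 0 ≤ waveSpeed ρ S := by rw [waveSpeed]; positivity
    have hv : |if LowerSet α k y then E.val α (stateIndex fun i => y (Sum.inl i)) else 0| ≤
        2 * waveSpeed ρ S := by
      split_ifs
      · exact E.abs_val_le hρ hS _ _
      · simpa using hw
    rw [abs_mul, abs_mul, hz, mul_one, abs_neg, abs_of_pos (by positivity)]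
    calc _ ≤ 1 / (2 * h) * (2 * waveSpeed ρ S) := by gcongr
      _ = _ := by field_simp
  · rw [E.axisTerm_eq α k h, onRegisters_smul_right, onRegisters_diagonal_shiftTerm,
      ← shiftBasis, ← star_shiftBasis, star_mul, ← Matrix.smul_mul, ← Matrix.mul_smul,
      ← Matrix.diagonal_smul]
    simp only [mul_assoc]
    congr 4
    funext y
    rw [Pi.smul_apply, smul_eq_mul, ← mul_assoc, div_mul_eq_mul_div, Complex.I_mul_I]
    push_cast
    split_ifs <;> push_cast <;> ring

theorem Eigendecomposition.norm_axisTerm_le (E : Eigendecomposition ρ S)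
    (hρ : 0 < ρ) (hS : S.PosDef) {h : ℝ} (hh : 0 < h)
    (α : Fin 3) (k : Fin n) : ‖axisTerm n h ρ S α k‖ ≤ waveSpeed ρ S / h := by
  obtain ⟨U, hU, d, hd, he⟩ := E.exists_diagonal_axisTerm hρ hS hh α k
  have hw : 0 ≤ waveSpeed ρ S := by rw [waveSpeed]; positivity
  rw [he, CStarRing.norm_mul_mem_unitary _ (Unitary.star_mem hU),
    CStarRing.norm_mem_unitary_mul _ hU, Matrix.l2_opNorm_diagonal]
  refine (pi_norm_le_iff_of_nonneg (by positivity)).2 fun y => ?_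
  rw [Complex.norm_real, Real.norm_eq_abs]
  exact hd y

theorem Eigendecomposition.star_axisTerm (E : Eigendecomposition ρ S)
    (hρ : 0 < ρ) (hS : S.PosDef) {h : ℝ} (hh : 0 < h)
    (α : Fin 3) (k : Fin n) : star (axisTerm n h ρ S α k) = axisTerm n h ρ S α k := by
  obtain ⟨U, hU, d, hd, he⟩ := E.exists_diagonal_axisTerm hρ hS hh α k
  rw [he, star_mul, star_mul, star_star, Matrix.star_eq_conjTranspose (Matrix.diagonal _),
    Matrix.diagonal_conjTranspose, mul_assoc]
  congr 3
  funext y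
  simp

theorem evolution_mem_unitaryGroup {ι : Type*} [Fintype ι] [DecidableEq ι] {X : Matrix ι ι ℂ}
    (hX : star X = X) (t : ℝ) : evolution X t ∈ Matrix.unitaryGroup ι ℂ := by
  have h : star (evolution X t) = NormedSpace.exp (-((-(Complex.I * (t : ℂ))) • X)) := by
    rw [evolution, Matrix.star_eq_conjTranspose, ← Matrix.exp_conjTranspose,
      ← Matrix.star_eq_conjTranspose, star_smul, hX, ← neg_smul]
    simp
  rw [Matrix.mem_unitaryGroup_iff, h, evolution, ← Matrix.exp_add_of_commute _ _
    (Commute.refl ((-(Complex.I * (t : ℂ))) • X)).neg_right, add_neg_cancel, NormedSpace.exp_zero]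

theorem evolution_div_pow {ι : Type*} [Fintype ι] [DecidableEq ι] (X : Matrix ι ι ℂ) (t : ℝ)
    {m : ℕ} (hm : m ≠ 0) : evolution X (t / m) ^ m = evolution X t := by
  rw [evolution, evolution, ← Matrix.exp_nsmul]
  congr 1
  rw [← Nat.cast_smul_eq_nsmul ℂ, smul_smul]
  congr 1
  have : (m : ℂ) ≠ 0 := Nat.cast_ne_zero.2 hm
  push_cast
  field_simp

theorem Eigendecomposition.norm_trotter2_le (E : Eigendecomposition ρ S)
    (hρ : 0 < ρ) (hS : S.PosDef) {h : ℝ} (hh : 0 < h)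
    (τ : ℝ) : ‖E.trotter2 n h τ‖ ≤ 1 := by
  have hl : ∀ x ∈ (List.finRange 3).flatMap (axisFactors n h ρ S (τ / 2)),
      x ∈ Matrix.unitaryGroup (Qubit n → Fin 2) ℂ := by
    intro x hx
    obtain ⟨α, -, hx⟩ := List.mem_flatMap.1 hx
    obtain ⟨k, -, rfl⟩ := List.mem_map.1 hx
    exact evolution_mem_unitaryGroup (E.star_axisTerm hρ hS hh α k) _
  rw [E.trotter2_eq]
  exact (CStarRing.norm_of_mem_unitary (mul_mem
    (list_prod_mem fun x hx => hl x (List.mem_reverse.1 hx)) (list_prod_mem hl))).le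

theorem Eigendecomposition.norm_evolution_hamiltonian_le (E : Eigendecomposition ρ S)
    (hρ : 0 < ρ) (hS : S.PosDef) {h : ℝ}
    (hh : 0 < h) (t : ℝ) : ‖evolution (hamiltonian n h ρ S) t‖ ≤ 1 := by
  refine (CStarRing.norm_of_mem_unitary (evolution_mem_unitaryGroup ?_ t)).le
  simp only [hamiltonian_eq n h hρ hS, star_sum, E.star_axisTerm hρ hS hh]

theorem Eigendecomposition.norm_evolution_sub_trotter2_le (E : Eigendecomposition ρ S)
    (hρ : 0 < ρ) (hS : S.PosDef) {h : ℝ}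
    (hh : 0 < h) {τ : ℝ} (hτ : 0 ≤ τ) :
    ‖evolution (hamiltonian n h ρ S) τ - E.trotter2 n h τ‖ ≤
      2 * (3 * n * waveSpeed ρ S * τ / h) ^ 3 := by
  set a : ℝ := 3 * n * waveSpeed ρ S * τ / h with ha
  -- The expansion applies for `a ≤ 1`; otherwise the right side is at least 2, the trivial bound
  -- for a difference of contractions.
  rcases le_total a 1 with ha1 | ha1
  · set l : List (Matrix (Qubit n → Fin 2) (Qubit n → Fin 2) ℂ) :=
      (List.finRange 3).flatMap fun α => (List.finRange n).map fun k =>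
        (-(Complex.I * (τ : ℂ))) • axisTerm n h ρ S α k with hl
    have hsum : l.sum = (-(Complex.I * (τ : ℂ))) • hamiltonian n h ρ S := by
      rw [hl, hamiltonian_eq n h hρ hS, Finset.smul_sum, List.flatMap, List.sum_flatten,
        List.map_map, Fin.sum_univ_def]
      congr 2
      funext α
      rw [Finset.smul_sum, Fin.sum_univ_def]
      rfl
    have hexp : (l.map fun x => NormedSpace.exp ((2⁻¹ : ℂ) • x)) =
        (List.finRange 3).flatMap (axisFactors n h ρ S (τ / 2)) := by
      rw [hl, List.map_flatMap]
      congr 1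
      funext α
      rw [List.map_map, axisFactors]
      congr 1
      funext k
      simp only [Function.comp_apply, evolution, smul_smul]
      congr 2
      push_cast
      ring
    have hnorm : (l.map norm).sum ≤ a := by
      have h1 : ∀ x ∈ l.map norm, x ≤ τ * (waveSpeed ρ S / h) := by
        intro x hx
        obtain ⟨y, hy, rfl⟩ := List.mem_map.1 hx
        obtain ⟨α, -, hy⟩ := List.mem_flatMap.1 hy
        obtain ⟨k, -, rfl⟩ := List.mem_map.1 hy
        rw [norm_smul, norm_neg, norm_mul, Complex.norm_I, one_mul, Complex.norm_real,
          Real.norm_of_nonneg hτ]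
        exact mul_le_mul_of_nonneg_left (E.norm_axisTerm_le hρ hS hh α k) hτ
      refine (List.sum_le_card_nsmul _ _ h1).trans (le_of_eq ?_)
      have h2 : (l.map norm).length = 3 * n := by
        simp [hl]
        omega
      rw [h2, nsmul_eq_mul, ha]
      push_cast
      ring
    have := norm_palindrome_sub_exp_le l hnorm ha1
    rwa [hexp, hsum, ← E.trotter2_eq] at this
  · calc _ ≤ ‖evolution (hamiltonian n h ρ S) τ‖ + ‖E.trotter2 n h τ‖ := norm_sub_le _ _
      _ ≤ 1 + 1 := add_le_add (E.norm_evolution_hamiltonian_le hρ hS hh τ)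
          (E.norm_trotter2_le hρ hS hh τ)
      _ = 2 * 1 := by norm_num
      _ ≤ _ := by gcongr; exact one_le_pow₀ ha1

theorem Eigendecomposition.norm_evolution_sub_trotter2_pow_le (E : Eigendecomposition ρ S)
    (hρ : 0 < ρ) (hS : S.PosDef)
    {h : ℝ} (hh : 0 < h) {T : ℝ} (hT : 0 ≤ T) {m : ℕ} (hm : m ≠ 0) :
    ‖evolution (hamiltonian n h ρ S) T - E.trotter2 n h (T / m) ^ m‖ ≤
      54 * (n * waveSpeed ρ S * T / h) ^ 3 / m ^ 2 := by
  have hm' : (0 : ℝ) < m := Nat.cast_pos.2 (Nat.pos_of_ne_zero hm)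
  rw [← evolution_div_pow _ T hm]
  refine (norm_pow_sub_pow_le (E.norm_evolution_hamiltonian_le hρ hS hh _)
    (E.norm_trotter2_le hρ hS hh _) m).trans ?_
  refine (mul_le_mul_of_nonneg_left (E.norm_evolution_sub_trotter2_le hρ hS hh
    (div_nonneg hT hm'.le)) hm'.le).trans (le_of_eq ?_)
  field_simp
  ring

end

/-! ### The number of steps -/

theorem rpow_waveSpeed {ρ : ℝ} (hρ : 0 < ρ) (S : Matrix (Fin 6) (Fin 6) ℝ) :
    waveSpeed ρ S ^ (3 / 2 : ℝ) = ρ ^ (-(3 / 4) : ℝ) * ‖S⁻¹‖ ^ (3 / 4 : ℝ) := by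
  rw [waveSpeed, Real.mul_rpow (by positivity) (by positivity), ← Real.rpow_mul hρ.le,
    ← Real.rpow_mul (norm_nonneg _)]
  norm_num

/-- All physical parameters enter the bound through the same quantity `Y = n w T / h` as in the
error estimate. -/
theorem cnotBound_eq {n : ℕ} {h ρ : ℝ} (hh : 0 < h) (hρ : 0 < ρ) (S : Matrix (Fin 6) (Fin 6) ℝ)
    {T ε : ℝ} (hT : 0 < T) :
    cnotBound n h ρ S T ε = (2880 : ℝ) ^ (3 / 2 : ℝ) *
      ((n * waveSpeed ρ S * T / h) ^ (3 / 2 : ℝ) / ε ^ (1 / 2 : ℝ)) *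
        (432 * (n : ℝ) ^ 2 + 378) := by
  have hw : 0 ≤ waveSpeed ρ S := by rw [waveSpeed]; positivity
  rw [Real.div_rpow (by positivity) hh.le, Real.mul_rpow (by positivity) hT.le,
    Real.mul_rpow (by positivity) hw, rpow_waveSpeed hρ, cnotBound]
  ring

theorem rpow_three_halves_sq {x : ℝ} (hx : 0 ≤ x) : (x ^ (3 / 2 : ℝ)) ^ 2 = x ^ 3 := by
  rw [← Real.rpow_natCast, ← Real.rpow_mul hx, ← Real.rpow_natCast]
  norm_num

theorem exists_steps {Y ε : ℝ} (hY : 0 ≤ Y) (hε : 0 < ε) :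
    ∃ m : ℕ, 1 ≤ m ∧ 54 * Y ^ 3 / m ^ 2 ≤ ε ∧
      (m = 1 ∨ 2 * (m : ℝ) ≤ (2880 : ℝ) ^ (3 / 2 : ℝ) * (Y ^ (3 / 2 : ℝ) / ε ^ (1 / 2 : ℝ))) := by
  -- The constant 8 is chosen because `8² = 64 ≥ 54`. Rounding up at most doubles `x` when `x > 1`,
  -- so `2m ≤ 4x`, and the constant `32` obtained is far below `2880 ^ (3 / 2)`.
  set x : ℝ := 8 * (Y ^ (3 / 2 : ℝ) / ε ^ (1 / 2 : ℝ)) with hx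
  have hx0 : 0 ≤ x := by positivity
  have hx2 : x ^ 2 = 64 * Y ^ 3 / ε := by
    rw [hx, mul_pow, div_pow, rpow_three_halves_sq hY, ← Real.sqrt_eq_rpow, Real.sq_sqrt hε.le]
    ring
  have hm1 : 1 ≤ max 1 ⌈x⌉₊ := le_max_left _ _
  refine ⟨max 1 ⌈x⌉₊, hm1, ?_, ?_⟩
  · have hxm : x ≤ (max 1 ⌈x⌉₊ : ℕ) :=
      (Nat.le_ceil x).trans (Nat.cast_le.2 (le_max_right _ _))
    have hm0 : (0 : ℝ) < (max 1 ⌈x⌉₊ : ℕ) := Nat.cast_pos.2 hm1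
    have h1 : x ^ 2 ≤ ((max 1 ⌈x⌉₊ : ℕ) : ℝ) ^ 2 := by gcongr
    rw [hx2, div_le_iff₀ hε] at h1
    rw [div_le_iff₀ (by positivity)]
    have : 0 ≤ Y ^ 3 := by positivity
    linarith
  · rcases le_or_gt x 1 with h1 | h1
    · exact Or.inl (max_eq_left (Nat.ceil_le.2 (by simpa using h1)))
    · right
      have h2 : ((max 1 ⌈x⌉₊ : ℕ) : ℝ) ≤ 2 * x := by
        rw [max_eq_right (Nat.one_le_ceil_iff.2 (zero_lt_one.trans h1))]
        linarith [Nat.ceil_lt_add_one hx0]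
      have h3 : (32 : ℝ) ≤ (2880 : ℝ) ^ (3 / 2 : ℝ) :=
        calc (32 : ℝ) ≤ (2880 : ℝ) ^ (1 : ℝ) := by norm_num
          _ ≤ _ := Real.rpow_le_rpow_of_exponent_le (by norm_num) (by norm_num)
      calc 2 * ((max 1 ⌈x⌉₊ : ℕ) : ℝ) ≤ 4 * x := by linarith
        _ = 32 * (Y ^ (3 / 2 : ℝ) / ε ^ (1 / 2 : ℝ)) := by rw [hx]; ring
        _ ≤ _ := by gcongr

theorem cnotBound_le {n : ℕ} (hn : 1 ≤ n) {h ρ : ℝ} (hh : 0 < h) (hρ : 0 < ρ)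
    (S : Matrix (Fin 6) (Fin 6) ℝ) {T ε : ℝ} (hT : 0 < T) (hε : 0 < ε) :
    cnotBound n h ρ S T ε ≤ (2880 : ℝ) ^ (3 / 2 : ℝ) / h ^ (3 / 2 : ℝ) * ρ ^ (-(3 / 4) : ℝ) *
      ‖S⁻¹‖ ^ (3 / 4 : ℝ) * 810 * (T ^ (3 / 2 : ℝ) / ε ^ (1 / 2 : ℝ)) * (n : ℝ) ^ (7 / 2 : ℝ) := by
  have hn' : (1 : ℝ) ≤ n := Nat.one_le_cast.2 hn
  -- Here `810 = 432 + 378`, using `1 ≤ n²`.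
  have h1 : (432 * (n : ℝ) ^ 2 + 378) ≤ 810 * (n : ℝ) ^ 2 := by nlinarith
  have h2 : (n : ℝ) ^ (7 / 2 : ℝ) = (n : ℝ) ^ (3 / 2 : ℝ) * (n : ℝ) ^ 2 := by
    rw [← Real.rpow_natCast, ← Real.rpow_add (by positivity)]
    norm_num
  rw [cnotBound, h2]
  refine (mul_le_mul_of_nonneg_left h1 (by positivity)).trans (le_of_eq ?_)
  have := Real.rpow_pos_of_pos hh (3 / 2)
  have := Real.rpow_pos_of_pos hε (1 / 2)
  field_simp

end

end ElasticWave
theorem mainTheorem3 (ρ h : ℝ) (hρ : 0 < ρ) (hh : 0 < h)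
    (S : Matrix (Fin 6) (Fin 6) ℝ) (hS : S.PosDef)
    (E : ElasticWave.Eigendecomposition ρ S) :
    (∀ n : ℕ, 1 ≤ n → ∀ T ε : ℝ, 0 < T → 0 < ε →
      Fintype.card (ElasticWave.Qubit n) = 3 * n + 4 ∧
      ∃ m : ℕ, 1 ≤ m ∧ ∃ C : ElasticWave.Circuit (ElasticWave.Qubit n),
        C.unitary = E.trotter2 n h (T / m) ^ m ∧
        ‖ElasticWave.evolution (ElasticWave.hamiltonian n h ρ S) T - C.unitary‖ ≤ ε ∧
        (C.cnotCount : ℝ) ≤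
          max (ElasticWave.cnotBound n h ρ S T ε) (2 * (432 * (n : ℝ) ^ 2 + 378))) ∧
    (∃ c : ℝ, ∀ n : ℕ, 1 ≤ n → ∀ T ε : ℝ, 0 < T → 0 < ε →
      ElasticWave.cnotBound n h ρ S T ε ≤
        c * (T ^ (3 / 2 : ℝ) / ε ^ (1 / 2 : ℝ)) * (n : ℝ) ^ (7 / 2 : ℝ)) := by
  refine ⟨fun n hn T ε hT hε => ⟨by simp [Fintype.card_sum, Fintype.card_prod]; omega, ?_⟩,
    _, fun n hn T ε hT hε => ElasticWave.cnotBound_le hn hh hρ S hT hε⟩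
  have hw : 0 ≤ ElasticWave.waveSpeed ρ S := by rw [ElasticWave.waveSpeed]; positivity
  obtain ⟨m, hm1, herr, hcount⟩ := ElasticWave.exists_steps
    (Y := n * ElasticWave.waveSpeed ρ S * T / h) (by positivity) hε
  obtain ⟨C, hC, hcost⟩ := (E.hasCost_trotter2 n h (T / m)).pow m
  refine ⟨m, hm1, C, hC, ?_, ?_⟩
  · rw [hC]
    exact (E.norm_evolution_sub_trotter2_pow_le hρ hS hh hT.le (by omega)).trans herr
  · have hcost' : (C.cnotCount : ℝ) ≤ m * (2 * (432 * (n : ℝ) ^ 2 + 378)) := by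
      refine (Nat.cast_le.2 hcost).trans ?_
      push_cast
      have hn' : (1 : ℝ) ≤ n := Nat.one_le_cast.2 hn
      gcongr
      -- The difference `2(432n² + 378) - (198n² + 162n + 1260)` equals `(n - 1)(666n + 504)`, so
      -- there is equality for `n = 1`.
      nlinarith
    refine hcost'.trans ?_
    -- A single step is covered by the second entry of the maximum; for more steps the factor 2 of
    -- the budget is absorbed into `2 * m`.
    rcases hcount with rfl | hcount
    · rw [Nat.cast_one, one_mul]
      exact le_max_right _ _
    · refine le_trans ?_ (le_max_left _ _)
      rw [ElasticWave.cnotBound_eq hh hρ S hT]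
      calc (m : ℝ) * (2 * (432 * (n : ℝ) ^ 2 + 378)) = 2 * m * (432 * (n : ℝ) ^ 2 + 378) := by ring
        _ ≤ _ := by gcongr
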